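/- Let $n \ge 1$ and $\mathbb{N} = \{0,1,2,\dots\}$. A weight sequence is a family $M = (M_\alpha)_{\alpha \in \mathbb{N}^n}$ of positive numbers with $M_0 = 1$ and $\lim_{|\alpha| \to \infty} M_\alpha^{1/|\alpha|} = \infty$. It is isotropic if $M_\alpha = M_{|\alpha|}$ for a sequence $(M_q)_{q \in \mathbb{N}}$, and log-convex if there is a convex function $F : [0,\infty)^n \to \mathbb{R}$ with $F(\alpha) = \log M_\alpha$ for all $\alpha \in \mathbb{N}^n$. Its associated function is $\omega_M(x) = \sup_{\alpha \in \mathbb{N}^n} \log (|x^\alpha| / M_\alpha)$, $x \in \mathbb{R}^n$ (with $\log 0 = -\infty$). Let $p \in [1,\infty]$. For weight sequences $M, A$ and $\lambda > 0$ let $E^{\lambda}_{M,A}$ be the Banach space of all (complex-valued) $f \in C^\infty(\mathbb{R}^n)$ such that $f^{(\alpha)} e^{\omega_A(\cdot/\lambda)} \in L^p(\mathbb{R}^n)$ for all $\alpha \in \mathbb{N}^n$ and $$ \|f\|_{\lambda} = \sup_{\alpha \in \mathbb{N}^n} \frac{\| f^{(\alpha)} e^{\omega_A(\cdot/\lambda)}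 \|_{L^p}}{\lambda^{|\alpha|} M_\alpha} < \infty . $$ Put $\mathcal{S}^{(M)}_{(A),p} = \bigcap_{\lambda > 0} E^\lambda_{M,A}$ with the projective limit topology (Beurling case) and $\mathcal{S}^{\{M\}}_{\{A\},p} = \bigcup_{\lambda > 0} E^\lambda_{M,A}$ with the locally convex inductive limit topology (Roumieu case). Write $[\,\cdot\,]$ for either $(\,\cdot\,)$ or $\{\,\cdot\,\}$, the same choice throughout. **Theorem.** Let $p \in [1,\infty]$ and let $M, N, A, B$ be isotropic log-convex weight sequences. Suppose that $\mathcal{S}^{[M]}_{[A],p} \neq \{0\}$. In each of the two cases the following statements are equivalent: (i) $M \preceq N$ and $A \preceq B$, i.e. there are $C, H > 0$ such that $M_q \le C H^q N_q$ and $A_q \le C H^q B_q$ for all $q \in \mathbb{N}$; (ii) $\mathcal{S}^{[M]}_{[A],p} \subseteq \mathcal{S}^{[N]}_{[B],p}$ as sets; (iii) $\mathcal{S}^{[M]}_{[A],p} \subseteq \mathcal{S}^{[N]}_{[B],p}$ continuously, i.e. the set inclusion holds and the inclusion map is continuous. -/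

import Mathlib

open MeasureTheory Filter Topology
open scoped ENNReal ContDiff

namespace GelfandShilov

/-- The order `|α| = α₁ + ⋯ + αₙ` of a multi-index. -/
def order {n : ℕ} (α : Fin n → ℕ) : ℕ := ∑ i, α i

/-- A weight sequence: positive numbers `M_α`, `α ∈ ℕⁿ`, with `M_0 = 1` and
`(M_α)^(1/|α|) → ∞` as `|α| → ∞`. -/
structure WeightSequence (n : ℕ) where
  val : (Fin n → ℕ) → ℝ
  pos : ∀ α, 0 < val α
  val_zero : val 0 = 1
  tendsto : Tendsto (fun α => val α ^ (1 / (order α : ℝ))) (comap order atTop) atTop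

/-- There is a convex `F : [0,∞)ⁿ → ℝ` with `F(α) = log M_α` for all `α ∈ ℕⁿ`. -/
def WeightSequence.LogConvex {n : ℕ} (M : WeightSequence n) : Prop :=
  ∃ F : (Fin n → ℝ) → ℝ, ConvexOn ℝ {x | ∀ i, 0 ≤ x i} F ∧
    ∀ α : Fin n → ℕ, F (fun i => (α i : ℝ)) = Real.log (M.val α)

/-- `M` is isotropic, given by the sequence `m = (m_q)`: `M_α = m_{|α|}`. -/
def WeightSequence.IsIsotropic {n : ℕ} (M : WeightSequence n) (m : ℕ → ℝ) : Prop :=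
  ∀ α, M.val α = m (order α)

/-- The associated function `ω_M(x) = sup_α log (|x^α| / M_α)`. Lean's convention `log 0 = 0`
(instead of `-∞`) does not affect the supremum, since the term with `α = 0` equals `0`. -/
noncomputable def WeightSequence.assoc {n : ℕ} (M : WeightSequence n)
    (x : EuclideanSpace ℝ (Fin n)) : ℝ :=
  ⨆ α : Fin n → ℕ, Real.log (|∏ i, x i ^ α i| / M.val α)

/-- Positive real numbers, the index set of weight systems. -/
abbrev PosReal := {r : ℝ // 0 < r}

/-- The weight sequence `(l^|α| M_α)_α`: the member with index `l` of the weight sequence system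
generated by `M`. -/
noncomputable def WeightSequence.scale {n : ℕ} (M : WeightSequence n) (l : PosReal) :
    WeightSequence n where
  val α := (l : ℝ) ^ order α * M.val α
  pos α := mul_pos (pow_pos l.2 _) (M.pos α)
  val_zero := by simp [order, M.val_zero]
  tendsto := by
    have h := M.tendsto.const_mul_atTop l.2
    refine h.congr' ?_
    have h1 : ∀ᶠ α : Fin n → ℕ in comap order atTop, 1 ≤ order α :=
      tendsto_comap.eventually (eventually_ge_atTop 1)
    filter_upwards [h1] with α hα
    have h0 : (order α : ℝ) ≠ 0 := by positivity
    rw [Real.mul_rpow (by have := l.2; positivity) (M.pos α).le, ← Real.rpow_natCast,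
      ← Real.rpow_mul l.2.le, mul_one_div_cancel h0, Real.rpow_one]

/-- The weight function `exp (ω_A(x / l))`: the member with index `l` of the weight function system
generated by `A`. -/
noncomputable def WeightSequence.weight {n : ℕ} (A : WeightSequence n) (l : PosReal)
    (x : EuclideanSpace ℝ (Fin n)) : ℝ :=
  Real.exp (A.assoc ((l : ℝ)⁻¹ • x))

/-- The partial derivative `∂f/∂x_i`. -/
noncomputable def partialDeriv {n : ℕ} (i : Fin n) (f : EuclideanSpace ℝ (Fin n) → ℂ) :
    EuclideanSpace ℝ (Fin n) → ℂ :=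
  fun x => fderiv ℝ f x (EuclideanSpace.single i 1)

/-- The partial derivative `f^(α) = ∂_1^{α_1} ⋯ ∂_n^{α_n} f` (used for smooth `f` only). -/
noncomputable def multiDeriv {n : ℕ} (α : Fin n → ℕ) (f : EuclideanSpace ℝ (Fin n) → ℂ) :
    EuclideanSpace ℝ (Fin n) → ℂ :=
  (List.finRange n).foldr (fun i g => (partialDeriv i)^[α i] g) f

/-- `‖f‖_{L^p, M, w} = sup_α ‖f^(α) w‖_{L^p} / M_α`, with values in `[0,∞]`. -/
noncomputable def eNorm {n : ℕ} (p : ℝ≥0∞) (M : WeightSequence n)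
    (w : EuclideanSpace ℝ (Fin n) → ℝ) (f : EuclideanSpace ℝ (Fin n) → ℂ) : ℝ≥0∞ :=
  ⨆ α : Fin n → ℕ, eLpNorm (fun x => w x • multiDeriv α f x) p volume / ENNReal.ofReal (M.val α)

section Helpers

variable {n : ℕ}

theorem WeightSequence.bddAbove (M : WeightSequence n) (x : EuclideanSpace ℝ (Fin n)) :
    BddAbove (Set.range fun α : Fin n → ℕ => Real.log (|∏ i, x i ^ α i| / M.val α)) := by
  have h1 : ∀ᶠ α : Fin n → ℕ in comap order atTop, ‖x‖ + 1 ≤ M.val α ^ (1 / (order α : ℝ)) :=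
    M.tendsto.eventually (eventually_ge_atTop _)
  rw [eventually_comap] at h1
  obtain ⟨k, hk⟩ := eventually_atTop.1 h1
  have hfin : Set.Finite (Set.Iic (fun _ : Fin n => k)) := Set.finite_Iic _
  obtain ⟨B, hB⟩ := (hfin.image fun α : Fin n → ℕ =>
    Real.log (|∏ i, x i ^ α i| / M.val α)).bddAbove
  refine ⟨max B 0, ?_⟩
  rintro _ ⟨α, rfl⟩
  by_cases hα : α ∈ Set.Iic (fun _ : Fin n => k)
  · exact le_max_of_le_left (hB ⟨α, hα, rfl⟩)
  · refine le_max_of_le_right ?_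
    have hlt : k < order α := by
      simp only [Set.mem_Iic, Pi.le_def, not_forall, not_le] at hα
      obtain ⟨i, hi⟩ := hα
      exact hi.trans_le (Finset.single_le_sum (f := α) (fun _ _ => Nat.zero_le _)
        (Finset.mem_univ i))
    have h2 := hk _ hlt.le α rfl
    have h0 : order α ≠ 0 := by omega
    have h3 : (‖x‖ + 1) ^ order α ≤ M.val α := by
      have := pow_le_pow_left₀ (by positivity) h2 (order α)
      rwa [one_div, Real.rpow_inv_natCast_pow (M.pos α).le h0] at this
    have h4 : |∏ i, x i ^ α i| ≤ (‖x‖ + 1) ^ order α := by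
      rw [Finset.abs_prod, order, ← Finset.prod_pow_eq_pow_sum]
      refine Finset.prod_le_prod (fun _ _ => abs_nonneg _) fun i _ => ?_
      rw [abs_pow]
      refine pow_le_pow_left₀ (abs_nonneg _) ?_ _
      have := PiLp.norm_apply_le x i
      rw [Real.norm_eq_abs] at this
      linarith
    refine Real.log_nonpos (div_nonneg (abs_nonneg _) (M.pos α).le) ?_
    exact (div_le_one (M.pos α)).2 (h4.trans h3)

theorem WeightSequence.assoc_nonneg (M : WeightSequence n) (x : EuclideanSpace ℝ (Fin n)) :
    0 ≤ M.assoc x := by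
  refine le_trans ?_ (le_ciSup (M.bddAbove x) 0)
  simp [M.val_zero]

theorem WeightSequence.assoc_mono (M : WeightSequence n) {x y : EuclideanSpace ℝ (Fin n)}
    (h : ∀ i, |y i| ≤ |x i|) : M.assoc y ≤ M.assoc x := by
  refine ciSup_le fun α => ?_
  by_cases h0 : ∏ i, y i ^ α i = 0
  · simpa [h0] using M.assoc_nonneg x
  · refine le_trans ?_ (le_ciSup (M.bddAbove x) α)
    refine Real.log_le_log (div_pos (abs_pos.2 h0) (M.pos α)) ?_
    refine div_le_div_of_nonneg_right ?_ (M.pos α).le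
    rw [Finset.abs_prod, Finset.abs_prod]
    refine Finset.prod_le_prod (fun _ _ => abs_nonneg _) fun i _ => ?_
    rw [abs_pow, abs_pow]
    exact pow_le_pow_left₀ (abs_nonneg _) (h i) _

theorem WeightSequence.weight_pos (A : WeightSequence n) (l : PosReal)
    (x : EuclideanSpace ℝ (Fin n)) : 0 < A.weight l x := Real.exp_pos _

theorem WeightSequence.weight_anti (A : WeightSequence n) {l m : PosReal} (h : l ≤ m)
    (x : EuclideanSpace ℝ (Fin n)) : A.weight m x ≤ A.weight l x := by
  refine Real.exp_le_exp.2 (A.assoc_mono fun i => ?_)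
  simp only [PiLp.smul_apply, smul_eq_mul, abs_mul]
  refine mul_le_mul_of_nonneg_right ?_ (abs_nonneg _)
  rw [abs_of_pos (inv_pos.2 m.2), abs_of_pos (inv_pos.2 l.2)]
  exact inv_anti₀ l.2 h

theorem WeightSequence.measurable_weight (A : WeightSequence n) (l : PosReal) :
    Measurable (A.weight l) := by
  unfold WeightSequence.weight WeightSequence.assoc
  refine Real.measurable_exp.comp (Measurable.iSup fun α => ?_)
  refine Real.measurable_log.comp (Measurable.div_const ?_ _)
  refine Continuous.measurable ?_
  fun_prop

theorem partialDeriv_contDiff (i : Fin n) {f : EuclideanSpace ℝ (Fin n) → ℂ}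
    (hf : ContDiff ℝ ∞ f) : ContDiff ℝ ∞ (partialDeriv i f) :=
  (hf.fderiv_right (m := ∞) (by simp)).clm_apply contDiff_const

theorem partialDeriv_add (i : Fin n) {f g : EuclideanSpace ℝ (Fin n) → ℂ}
    (hf : ContDiff ℝ ∞ f) (hg : ContDiff ℝ ∞ g) :
    partialDeriv i (f + g) = partialDeriv i f + partialDeriv i g := by
  funext x
  simp only [partialDeriv, Pi.add_apply]
  rw [fderiv_add (hf.differentiable (by simp) x) (hg.differentiable (by simp) x)]
  rfl

theorem partialDeriv_smul (i : Fin n) (c : ℂ) {f : EuclideanSpace ℝ (Fin n) → ℂ}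
    (hf : ContDiff ℝ ∞ f) : partialDeriv i (c • f) = c • partialDeriv i f := by
  funext x
  simp only [partialDeriv, Pi.smul_apply]
  rw [fderiv_const_smul (hf.differentiable (by simp) x)]
  rfl

theorem partialDeriv_iterate_contDiff (i : Fin n) (k : ℕ) {f : EuclideanSpace ℝ (Fin n) → ℂ}
    (hf : ContDiff ℝ ∞ f) : ContDiff ℝ ∞ ((partialDeriv i)^[k] f) := by
  induction k with
  | zero => exact hf
  | succ k ih => rw [Function.iterate_succ_apply']; exact partialDeriv_contDiff i ih

theorem partialDeriv_iterate_add (i : Fin n) (k : ℕ) {f g : EuclideanSpace ℝ (Fin n) → ℂ}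
    (hf : ContDiff ℝ ∞ f) (hg : ContDiff ℝ ∞ g) :
    (partialDeriv i)^[k] (f + g) = (partialDeriv i)^[k] f + (partialDeriv i)^[k] g := by
  induction k with
  | zero => rfl
  | succ k ih =>
    simp only [Function.iterate_succ_apply', ih]
    exact partialDeriv_add i (partialDeriv_iterate_contDiff i k hf)
      (partialDeriv_iterate_contDiff i k hg)

theorem partialDeriv_iterate_smul (i : Fin n) (k : ℕ) (c : ℂ)
    {f : EuclideanSpace ℝ (Fin n) → ℂ} (hf : ContDiff ℝ ∞ f) :
    (partialDeriv i)^[k] (c • f) = c • (partialDeriv i)^[k] f := by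
  induction k with
  | zero => rfl
  | succ k ih =>
    simp only [Function.iterate_succ_apply', ih]
    exact partialDeriv_smul i c (partialDeriv_iterate_contDiff i k hf)

theorem multiDeriv_contDiff (α : Fin n → ℕ) {f : EuclideanSpace ℝ (Fin n) → ℂ}
    (hf : ContDiff ℝ ∞ f) : ContDiff ℝ ∞ (multiDeriv α f) := by
  unfold multiDeriv
  induction List.finRange n with
  | nil => exact hf
  | cons i L ih => exact partialDeriv_iterate_contDiff i (α i) ih

theorem multiDeriv_add (α : Fin n → ℕ) {f g : EuclideanSpace ℝ (Fin n) → ℂ}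
    (hf : ContDiff ℝ ∞ f) (hg : ContDiff ℝ ∞ g) :
    multiDeriv α (f + g) = multiDeriv α f + multiDeriv α g := by
  have hc : ∀ (L : List (Fin n)) {h : EuclideanSpace ℝ (Fin n) → ℂ}, ContDiff ℝ ∞ h →
      ContDiff ℝ ∞ (L.foldr (fun i g => (partialDeriv i)^[α i] g) h) := by
    intro L h hh
    induction L with
    | nil => exact hh
    | cons i L ih => exact partialDeriv_iterate_contDiff i (α i) ih
  unfold multiDeriv
  induction List.finRange n with
  | nil => rfl
  | cons i L ih =>
    simp only [List.foldr_cons, ih]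
    exact partialDeriv_iterate_add i (α i) (hc L hf) (hc L hg)

theorem multiDeriv_smul (α : Fin n → ℕ) (c : ℂ) {f : EuclideanSpace ℝ (Fin n) → ℂ}
    (hf : ContDiff ℝ ∞ f) : multiDeriv α (c • f) = c • multiDeriv α f := by
  have hc : ∀ (L : List (Fin n)) {h : EuclideanSpace ℝ (Fin n) → ℂ}, ContDiff ℝ ∞ h →
      ContDiff ℝ ∞ (L.foldr (fun i g => (partialDeriv i)^[α i] g) h) := by
    intro L h hh
    induction L with
    | nil => exact hh
    | cons i L ih => exact partialDeriv_iterate_contDiff i (α i) ih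
  unfold multiDeriv
  induction List.finRange n with
  | nil => rfl
  | cons i L ih =>
    simp only [List.foldr_cons, ih]
    exact partialDeriv_iterate_smul i (α i) c (hc L hf)

theorem weighted_add (α : Fin n → ℕ) (w : EuclideanSpace ℝ (Fin n) → ℝ)
    {f g : EuclideanSpace ℝ (Fin n) → ℂ} (hf : ContDiff ℝ ∞ f) (hg : ContDiff ℝ ∞ g) :
    (fun x => w x • multiDeriv α (f + g) x) =
      (fun x => w x • multiDeriv α f x) + fun x => w x • multiDeriv α g x := by
  funext x
  simp [multiDeriv_add α hf hg]

theorem weighted_smul (α : Fin n → ℕ) (w : EuclideanSpace ℝ (Fin n) → ℝ) (c : ℂ)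
    {f : EuclideanSpace ℝ (Fin n) → ℂ} (hf : ContDiff ℝ ∞ f) :
    (fun x => w x • multiDeriv α (c • f) x) = c • fun x => w x • multiDeriv α f x := by
  funext x
  simp [multiDeriv_smul α c hf, mul_left_comm]

theorem eNorm_add_le {p : ℝ≥0∞} (hp : 1 ≤ p) (M : WeightSequence n)
    (w : EuclideanSpace ℝ (Fin n) → ℝ) {f g : EuclideanSpace ℝ (Fin n) → ℂ}
    (hf : ContDiff ℝ ∞ f) (hg : ContDiff ℝ ∞ g)
    (hfm : ∀ α, MemLp (fun x => w x • multiDeriv α f x) p volume)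
    (hgm : ∀ α, MemLp (fun x => w x • multiDeriv α g x) p volume) :
    eNorm p M w (f + g) ≤ eNorm p M w f + eNorm p M w g := by
  refine iSup_le fun α => ?_
  rw [weighted_add α w hf hg]
  refine (ENNReal.div_le_div_right (eLpNorm_add_le (hfm α).1 (hgm α).1 hp) _).trans ?_
  rw [ENNReal.add_div]
  exact add_le_add (le_iSup (fun α => eLpNorm (fun x => w x • multiDeriv α f x) p volume /
    ENNReal.ofReal (M.val α)) α) (le_iSup (fun α => eLpNorm (fun x => w x • multiDeriv α g x) p
    volume / ENNReal.ofReal (M.val α)) α)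

theorem eNorm_smul (p : ℝ≥0∞) (M : WeightSequence n) (w : EuclideanSpace ℝ (Fin n) → ℝ) (c : ℂ)
    {f : EuclideanSpace ℝ (Fin n) → ℂ} (hf : ContDiff ℝ ∞ f) :
    eNorm p M w (c • f) = ‖c‖ₑ * eNorm p M w f := by
  unfold eNorm
  rw [ENNReal.mul_iSup]
  refine iSup_congr fun α => ?_
  rw [weighted_smul α w c hf, eLpNorm_const_smul, mul_div_assoc]

theorem multiDeriv_zero (α : Fin n → ℕ) :
    multiDeriv α (0 : EuclideanSpace ℝ (Fin n) → ℂ) = 0 := by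
  have h := multiDeriv_smul α 0 (f := (0 : EuclideanSpace ℝ (Fin n) → ℂ)) contDiff_const
  simpa using h

theorem eNorm_zero (p : ℝ≥0∞) (M : WeightSequence n) (w : EuclideanSpace ℝ (Fin n) → ℝ) :
    eNorm p M w 0 = 0 := by
  simp [eNorm, multiDeriv_zero]

end Helpers

/-- The space of all (complex-valued) `f ∈ C^∞(ℝⁿ)` such that `f^(α) w ∈ L^p` for all `α` and
`sup_α ‖f^(α) w‖_{L^p} / M_α < ∞`. -/
noncomputable def stepSpace {n : ℕ} (p : ℝ≥0∞) [Fact (1 ≤ p)] (M : WeightSequence n)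
    (w : EuclideanSpace ℝ (Fin n) → ℝ) : Submodule ℂ (EuclideanSpace ℝ (Fin n) → ℂ) where
  carrier := {f | ContDiff ℝ ∞ f ∧ (∀ α, MemLp (fun x => w x • multiDeriv α f x) p volume) ∧
    eNorm p M w f < ⊤}
  add_mem' := by
    rintro f g ⟨hf, hfm, hfn⟩ ⟨hg, hgm, hgn⟩
    refine ⟨hf.add hg, fun α => ?_, ?_⟩
    · rw [weighted_add α w hf hg]; exact (hfm α).add (hgm α)
    · exact (eNorm_add_le Fact.out M w hf hg hfm hgm).trans_lt (ENNReal.add_lt_top.2 ⟨hfn, hgn⟩)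
  zero_mem' := by
    refine ⟨contDiff_const, fun α => ?_, ?_⟩
    · simp [multiDeriv_zero]
    · rw [eNorm_zero]; exact ENNReal.zero_lt_top
  smul_mem' := by
    rintro c f ⟨hf, hfm, hfn⟩
    refine ⟨contDiff_const.smul hf, fun α => ?_, ?_⟩
    · rw [weighted_smul α w c hf]; exact (hfm α).const_smul c
    · rw [eNorm_smul p M w c hf]; exact ENNReal.mul_lt_top enorm_lt_top hfn

/-- The norm `‖f‖_{L^p, M, w}` on `stepSpace p M w`. -/
noncomputable def stepNorm {n : ℕ} (p : ℝ≥0∞) [Fact (1 ≤ p)] (M : WeightSequence n)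
    (w : EuclideanSpace ℝ (Fin n) → ℝ) : Seminorm ℂ (stepSpace p M w) :=
  Seminorm.of (fun f => (eNorm p M w (f : EuclideanSpace ℝ (Fin n) → ℂ)).toReal)
    (fun f g => by
      rw [← ENNReal.toReal_add f.2.2.2.ne g.2.2.2.ne]
      exact ENNReal.toReal_mono (ENNReal.add_lt_top.2 ⟨f.2.2.2, g.2.2.2⟩).ne
        (eNorm_add_le Fact.out M w f.2.1 g.2.1 f.2.2.1 g.2.2.1))
    (fun c f => by
      rw [Submodule.coe_smul, eNorm_smul p M w c f.2.1, ENNReal.toReal_mul]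
      simp)

/-- The norm topology of `stepSpace p M w`. -/
@[reducible]
noncomputable def stepTopology {n : ℕ} (p : ℝ≥0∞) [Fact (1 ≤ p)] (M : WeightSequence n)
    (w : EuclideanSpace ℝ (Fin n) → ℝ) : TopologicalSpace (stepSpace p M w) :=
  (stepNorm p M w).toAddGroupSeminorm.toSeminormedAddCommGroup.toPseudoMetricSpace.toUniformSpace.toTopologicalSpace

/-- The Banach space with index `l` in the limits that define the spaces `S^[M]_[A],p`. -/
noncomputable abbrev gsStep {n : ℕ} (p : ℝ≥0∞) [Fact (1 ≤ p)] (M A : WeightSequence n) (l : PosReal) :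
    Submodule ℂ (EuclideanSpace ℝ (Fin n) → ℂ) :=
  stepSpace p (M.scale l) (A.weight l)

theorem gsStep_mono {n : ℕ} (p : ℝ≥0∞) [Fact (1 ≤ p)] (M A : WeightSequence n) :
    Monotone (gsStep p M A) := by
  rintro l m h f ⟨hf, hfm, hfn⟩
  have hle : ∀ α x, ‖A.weight m x • multiDeriv α f x‖ ≤ ‖A.weight l x • multiDeriv α f x‖ := by
    intro α x
    rw [norm_smul, norm_smul, Real.norm_of_nonneg (A.weight_pos m x).le,
      Real.norm_of_nonneg (A.weight_pos l x).le]
    exact mul_le_mul_of_nonneg_right (A.weight_anti h x) (norm_nonneg _)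
  refine ⟨hf, fun α => (hfm α).mono ?_ (Eventually.of_forall (hle α)), lt_of_le_of_lt ?_ hfn⟩
  · exact ((A.measurable_weight m).smul
      (multiDeriv_contDiff α hf).continuous.measurable).aestronglyMeasurable
  · refine iSup_mono fun α => ENNReal.div_le_div (eLpNorm_mono (hle α)) (ENNReal.ofReal_le_ofReal ?_)
    exact mul_le_mul_of_nonneg_right (pow_le_pow_left₀ l.2.le h _) (M.pos α).le

/-- The Beurling space `S^(M)_(A),p`: the intersection of all steps. -/
noncomputable def beurling {n : ℕ} (p : ℝ≥0∞) [Fact (1 ≤ p)] (M A : WeightSequence n) :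
    Submodule ℂ (EuclideanSpace ℝ (Fin n) → ℂ) :=
  ⨅ l : PosReal, gsStep p M A l

/-- The projective limit topology on `S^(M)_(A),p`. -/
@[reducible]
noncomputable def beurlingTopology {n : ℕ} (p : ℝ≥0∞) [Fact (1 ≤ p)] (M A : WeightSequence n) :
    TopologicalSpace (beurling p M A) :=
  ⨅ l : PosReal, TopologicalSpace.induced
    (Submodule.inclusion (iInf_le (gsStep p M A) l : beurling p M A ≤ gsStep p M A l))
    (stepTopology p (M.scale l) (A.weight l))

/-- The Roumieu space `S^{M}_{A},p`: the union of all steps. -/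
noncomputable def roumieu {n : ℕ} (p : ℝ≥0∞) [Fact (1 ≤ p)] (M A : WeightSequence n) :
    Submodule ℂ (EuclideanSpace ℝ (Fin n) → ℂ) where
  carrier := {f | ∃ l : PosReal, f ∈ gsStep p M A l}
  add_mem' := by
    rintro f g ⟨l, hl⟩ ⟨m, hm⟩
    exact ⟨max l m, add_mem (gsStep_mono p M A (le_max_left l m) hl)
      (gsStep_mono p M A (le_max_right l m) hm)⟩
  zero_mem' := ⟨⟨1, one_pos⟩, zero_mem _⟩
  smul_mem' := by
    rintro c f ⟨l, hl⟩
    exact ⟨l, Submodule.smul_mem _ c hl⟩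

theorem gsStep_le_roumieu {n : ℕ} (p : ℝ≥0∞) [Fact (1 ≤ p)] (M A : WeightSequence n)
    (l : PosReal) : gsStep p M A l ≤ roumieu p M A :=
  fun _ hf => ⟨l, hf⟩

/-- The inductive limit topology on `S^{M}_{A},p` in the category of locally convex spaces: the
finest locally convex vector space topology for which the inclusions of all steps are continuous.
(In Mathlib's order on topologies, finer is smaller; the infimum of a family of locally convex
topologies is the locally convex topology that they generate.) -/
@[reducible]
noncomputable def roumieuTopology {n : ℕ} (p : ℝ≥0∞) [Fact (1 ≤ p)] (M A : WeightSequence n) :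
    TopologicalSpace (roumieu p M A) :=
  sInf {t | (∀ l : PosReal, Continuous[stepTopology p (M.scale l) (A.weight l), t]
      (Submodule.inclusion (gsStep_le_roumieu p M A l))) ∧
    @IsTopologicalAddGroup (roumieu p M A) t _ ∧
    @ContinuousSMul ℂ (roumieu p M A) _ _ t ∧
    @LocallyConvexSpace ℝ (roumieu p M A) _ _ _ _ t}

end GelfandShilov

namespace GelfandShilov

/-! ### Calculus of multi-index derivatives, translations and modulations. -/

section Derivatives

variable {n : ℕ}

/-! Domination of the sequences gives continuity directly. If `m q ≤ C * H ^ q * ν q` and `a q ≤ C *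
H ^ q * b q`, the step with index `l` of the source embeds into the step with index `H l` of the
target with norm at most `C * C` (`eNorm_dilate_le`). The universal properties of the two limit
topologies do the rest.

The content is that set inclusion alone forces domination. Fix a nonzero `f` in the source and an
axis `i`. Translating `f` by `t` along the axis costs a factor `exp (A.axial i (|t| / l))` when
passing from step `l` to step `2 l`. Multiplying `f` by the character `exp (I t x_i)` costs `exp
(M.axial i (|t| / l))`, by Leibniz' rule and `m j * m k ≤ m (j + k)`. Normalized by these factors, a
sequence of translates or modulations is bounded in the source, so its absolutely convergent
combinations stay there (`tsum_mem_stepSpace`) and by inclusion belong to the target.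

Membership in the target is then tested by functionals weighted with the growth of the target:
integration against a translated bump for `B`, evaluation of the Fourier transform at a shifted
frequency for `N`. They are bounded on each combination. Banach-Steinhaus on `ℓ¹`, evaluated at the
unit vectors (`exists_bound_of_pointwise`), therefore bounds the diagonal pairings, which compare
exactly the two growth rates (`detects_translates`, `detects_modulations`). Choosing the sequence
from a supposed counterexample yields `V (r * t) ≤ U (s * t) + C` for large `t`, where `U` and `V`
are the associated functions of source and target along the axis (`beurling_transfer`,
`roumieu_transfer`).

Finally, log-convexity allows the sequences to be recovered from the associated functions, because
every index attains the supremum at some point (`exists_pow_mul_le`, `dominated_of_axial_le`). -/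

theorem partialDeriv_comm (i j : Fin n) {f : EuclideanSpace ℝ (Fin n) → ℂ}
    (hf : ContDiff ℝ ∞ f) :
    partialDeriv i (partialDeriv j f) = partialDeriv j (partialDeriv i f) := by
  funext x
  have h2 : ∀ i j : Fin n, partialDeriv i (partialDeriv j f) x =
      fderiv ℝ (fderiv ℝ f) x (EuclideanSpace.single i 1) (EuclideanSpace.single j 1) := by
    intro i j
    have hd : DifferentiableAt ℝ (fderiv ℝ f) x :=
      (hf.fderiv_right (m := ∞) (by simp)).differentiable (by simp) x
    change fderiv ℝ (fun y => fderiv ℝ f y (EuclideanSpace.single j 1)) x _ = _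
    rw [fderiv_clm_apply hd (differentiableAt_const _)]
    simp
  rw [h2, h2]
  refine (hf.contDiffAt.isSymmSndFDerivAt ?_).eq _ _
  rw [minSmoothness_of_isRCLikeNormedField]
  exact WithTop.coe_le_coe.2 le_top

theorem partialDeriv_iterate_comm (i j : Fin n) (k : ℕ) {f : EuclideanSpace ℝ (Fin n) → ℂ}
    (hf : ContDiff ℝ ∞ f) :
    (partialDeriv i)^[k] (partialDeriv j f) = partialDeriv j ((partialDeriv i)^[k] f) := by
  induction k with
  | zero => rfl
  | succ k ih =>
    rw [Function.iterate_succ_apply', Function.iterate_succ_apply', ih,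
      partialDeriv_comm i j (partialDeriv_iterate_contDiff i k hf)]

theorem multiDeriv_zero_index (f : EuclideanSpace ℝ (Fin n) → ℂ) : multiDeriv 0 f = f := by
  unfold multiDeriv
  induction List.finRange n with
  | nil => rfl
  | cons i L ih => simp

/-- The fold applies the partial derivatives in a fixed order, so the extra `∂_i` appears in the
middle and must be commuted to the front. Lists without repetition are the right generality for the
induction: the raised entry is then met exactly once. -/
theorem multiDeriv_add_single (α : Fin n → ℕ) (i : Fin n) {f : EuclideanSpace ℝ (Fin n) → ℂ}
    (hf : ContDiff ℝ ∞ f) :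
    multiDeriv (α + Pi.single i 1) f = partialDeriv i (multiDeriv α f) := by
  have hc : ∀ (L : List (Fin n)),
      ContDiff ℝ ∞ (L.foldr (fun i g => (partialDeriv i)^[α i] g) f) := by
    intro L
    induction L with
    | nil => exact hf
    | cons i L ih => exact partialDeriv_iterate_contDiff i (α i) ih
  have key : ∀ L : List (Fin n), L.Nodup →
      L.foldr (fun j g => (partialDeriv j)^[(α + Pi.single i 1 : Fin n → ℕ) j] g) f =
      if i ∈ L then partialDeriv i (L.foldr (fun j g => (partialDeriv j)^[α j] g) f)
      else L.foldr (fun j g => (partialDeriv j)^[α j] g) f := by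
    intro L hL
    induction L with
    | nil => simp
    | cons j L ih =>
      rw [List.nodup_cons] at hL
      simp only [List.foldr_cons]
      rw [ih hL.2]
      by_cases hij : i = j
      · subst hij
        simp only [hL.1, if_false, List.mem_cons_self, if_true, Pi.add_apply, Pi.single_eq_same]
        rw [Function.iterate_succ_apply']
      · have h1 : (α + Pi.single i 1 : Fin n → ℕ) j = α j := by simp [Ne.symm hij]
        rw [h1]
        by_cases hm : i ∈ L
        · simp only [hm, if_true, List.mem_cons_of_mem]
          exact partialDeriv_iterate_comm j i _ (hc L)
        · simp [hm, hij]
  have h := key _ (List.nodup_finRange n)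
  rw [if_pos (List.mem_finRange i)] at h
  exact h

theorem multiDeriv_add_single_nat (α : Fin n → ℕ) (i : Fin n) (k : ℕ)
    {f : EuclideanSpace ℝ (Fin n) → ℂ} (hf : ContDiff ℝ ∞ f) :
    multiDeriv (α + Pi.single i k) f = (partialDeriv i)^[k] (multiDeriv α f) := by
  induction k with
  | zero => simp
  | succ k ih =>
    rw [Pi.single_add, ← add_assoc, multiDeriv_add_single _ _ hf, ih, Function.iterate_succ_apply']

/-- Induction on multi-indices by raising one entry at a time. -/
theorem multiIndex_induction {P : (Fin n → ℕ) → Prop} (h0 : P 0)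
    (hs : ∀ α i, P α → P (α + Pi.single i 1)) (α : Fin n → ℕ) : P α := by
  induction hk : order α generalizing α with
  | zero =>
    have : α = 0 := by
      funext i
      have := Finset.sum_eq_zero_iff.1 hk i (Finset.mem_univ i)
      simpa using this
    exact this ▸ h0
  | succ k ih =>
    obtain ⟨i, hi⟩ : ∃ i, α i ≠ 0 := by
      by_contra! h
      simp [order, h] at hk
    have hα : α = (α - Pi.single i 1) + Pi.single i 1 := by
      funext j
      by_cases hj : j = i
      · subst hj; simp; omega
      · simp [hj]
    have ho : order α = order (α - Pi.single i 1) + 1 := by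
      conv_lhs => rw [hα]
      simp [order, Finset.sum_add_distrib]
    rw [hα]
    exact hs _ _ (ih _ (by omega))

theorem order_add (α β : Fin n → ℕ) : order (α + β) = order α + order β := by
  simp [order, Finset.sum_add_distrib]

theorem order_single (i : Fin n) (k : ℕ) : order (Pi.single i k : Fin n → ℕ) = k := by
  simp [order]

theorem order_zero : order (0 : Fin n → ℕ) = 0 := by
  simp [order]

/-- Translation commutes with derivatives. -/
theorem multiDeriv_comp_sub (α : Fin n → ℕ) (y : EuclideanSpace ℝ (Fin n))
    {f : EuclideanSpace ℝ (Fin n) → ℂ} (hf : ContDiff ℝ ∞ f) :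
    multiDeriv α (fun x => f (x - y)) = fun x => multiDeriv α f (x - y) := by
  have hf' : ContDiff ℝ ∞ (fun x => f (x - y)) := hf.comp (contDiff_id.sub contDiff_const)
  induction α using multiIndex_induction with
  | h0 => simp [multiDeriv_zero_index]
  | hs α i ih =>
    rw [multiDeriv_add_single _ _ hf', multiDeriv_add_single _ _ hf, ih]
    funext x
    simp only [partialDeriv]
    rw [fderiv_comp_sub (f := multiDeriv α f) y]

/-- The character `x ↦ exp (i τ x_i)`. -/
noncomputable def modulation (i : Fin n) (τ : ℝ) (x : EuclideanSpace ℝ (Fin n)) : ℂ :=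
  Complex.exp (Complex.I * ((τ * x i : ℝ) : ℂ))

theorem norm_modulation (i : Fin n) (τ : ℝ) (x : EuclideanSpace ℝ (Fin n)) :
    ‖modulation i τ x‖ = 1 := by
  rw [modulation, mul_comm, Complex.norm_exp_ofReal_mul_I]

theorem modulation_contDiff (i : Fin n) (τ : ℝ) : ContDiff ℝ ∞ (modulation i τ) := by
  unfold modulation
  refine Complex.contDiff_exp.comp (contDiff_const.mul ?_)
  refine Complex.ofRealCLM.contDiff.comp (contDiff_const.mul ?_)
  exact (EuclideanSpace.proj (𝕜 := ℝ) i).contDiff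

theorem partialDeriv_modulation (i j : Fin n) (τ : ℝ) (x : EuclideanSpace ℝ (Fin n)) :
    partialDeriv j (modulation i τ) x =
      if j = i then Complex.I * τ * modulation i τ x else 0 := by
  have h1 : HasFDerivAt (fun x : EuclideanSpace ℝ (Fin n) => Complex.I * ((τ * x i : ℝ) : ℂ))
      (Complex.I • (Complex.ofRealCLM ∘L (τ • EuclideanSpace.proj (𝕜 := ℝ) i))) x := by
    refine HasFDerivAt.const_mul ?_ _
    exact Complex.ofRealCLM.hasFDerivAt.comp x
      ((EuclideanSpace.proj (𝕜 := ℝ) i).hasFDerivAt.const_mul τ)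
  have h2 := h1.cexp
  rw [partialDeriv]
  change fderiv ℝ (fun x : EuclideanSpace ℝ (Fin n) =>
    Complex.exp (Complex.I * ((τ * x i : ℝ) : ℂ))) x _ = _
  rw [h2.fderiv]
  by_cases hij : j = i
  · subst hij; simp [modulation]; ring
  · simp [hij, Ne.symm hij]

theorem partialDeriv_mul (i : Fin n) {f g : EuclideanSpace ℝ (Fin n) → ℂ}
    (hf : ContDiff ℝ ∞ f) (hg : ContDiff ℝ ∞ g) :
    partialDeriv i (f * g) = partialDeriv i f * g + f * partialDeriv i g := by
  funext x
  simp only [partialDeriv, Pi.add_apply, Pi.mul_apply]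
  rw [fderiv_mul (hf.differentiable (by simp) x) (hg.differentiable (by simp) x)]
  simp
  ring

theorem partialDeriv_modulation_mul (i j : Fin n) (τ : ℝ) {f : EuclideanSpace ℝ (Fin n) → ℂ}
    (hf : ContDiff ℝ ∞ f) :
    partialDeriv j (modulation i τ * f) =
      modulation i τ * (partialDeriv j f + if j = i then (Complex.I * τ) • f else 0) := by
  rw [partialDeriv_mul j (modulation_contDiff i τ) hf]
  funext x
  simp only [Pi.add_apply, Pi.mul_apply, partialDeriv_modulation]
  by_cases h : j = i <;> simp [h]
  ring

/-- Leibniz' rule for the derivatives of a modulated function. -/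
theorem multiDeriv_modulation_mul (i : Fin n) (τ : ℝ) {f : EuclideanSpace ℝ (Fin n) → ℂ}
    (hf : ContDiff ℝ ∞ f) (β : Fin n → ℕ) (hβ : β i = 0) (k : ℕ) :
    multiDeriv (β + Pi.single i k) (modulation i τ * f) =
      modulation i τ * ∑ j ∈ Finset.range (k + 1),
        ((k.choose j : ℂ) * (Complex.I * τ) ^ (k - j)) • multiDeriv (β + Pi.single i j) f := by
  have hmf : ContDiff ℝ ∞ (modulation i τ * f) := (modulation_contDiff i τ).mul hf
  -- The character depends on `x_i` only, so derivatives in the other directions pass through it.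
  -- What remains is a one-variable problem in `∂_i`.
  have h1 : ∀ β : Fin n → ℕ, β i = 0 →
      multiDeriv β (modulation i τ * f) = modulation i τ * multiDeriv β f := by
    intro β
    induction β using multiIndex_induction with
    | h0 => simp [multiDeriv_zero_index]
    | hs β j ih =>
      intro h
      have hji : j ≠ i := by
        rintro rfl
        simp at h
      have hb : β i = 0 := by simpa [Pi.single_apply, hji.symm] using h
      rw [multiDeriv_add_single _ _ hmf, multiDeriv_add_single _ _ hf, ih hb,
        partialDeriv_modulation_mul _ _ _ (multiDeriv_contDiff β hf)]
      simp [hji]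
  rw [multiDeriv_add_single_nat _ _ _ hmf, h1 β hβ]
  set u := multiDeriv β f with hu
  have hus : ContDiff ℝ ∞ u := multiDeriv_contDiff β hf
  -- On smooth functions `∂_i` is a linear operator `D`, and differentiating the product with the
  -- character turns it into `D + I τ`. The two summands commute, so Leibniz' rule becomes the
  -- binomial theorem in the endomorphism ring.
  let S : Submodule ℂ (EuclideanSpace ℝ (Fin n) → ℂ) :=
    { carrier := {f | ContDiff ℝ ∞ f}
      add_mem' := fun hf hg => ContDiff.add (𝕜 := ℝ) (n := ∞) hf hg
      zero_mem' := contDiff_const (𝕜 := ℝ) (n := ∞) (c := (0 : ℂ))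
      smul_mem' := fun c _ hf => ContDiff.const_smul (𝕜 := ℝ) (n := ∞) c hf }
  let D : Module.End ℂ S :=
    { toFun := fun g => ⟨partialDeriv i g.1, partialDeriv_contDiff i g.2⟩
      map_add' := fun g h => Subtype.ext (partialDeriv_add i g.2 h.2)
      map_smul' := fun c g => Subtype.ext (partialDeriv_smul i c g.2) }
  let c : ℂ := Complex.I * τ
  let T : Module.End ℂ S := D + c • 1
  have hD : ∀ (j : ℕ) (g : S), ((D ^ j) g).1 = (partialDeriv i)^[j] g.1 := by
    intro j g
    induction j with
    | zero => rfl
    | succ j ih => rw [pow_succ', Module.End.mul_apply, Function.iterate_succ_apply', ← ih]; rfl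
  have hT : ∀ (j : ℕ) (g : S),
      (partialDeriv i)^[j] (modulation i τ * g.1) = modulation i τ * ((T ^ j) g).1 := by
    intro j g
    induction j with
    | zero => rfl
    | succ j ih =>
      rw [Function.iterate_succ_apply', ih, partialDeriv_modulation_mul _ _ _ ((T ^ j) g).2,
        pow_succ', Module.End.mul_apply]
      simp only [if_true]
      rfl
  have hcomm : Commute D (c • 1) := (Commute.one_right D).smul_right c
  rw [hT k ⟨u, hus⟩, hcomm.add_pow]
  congr 1
  rw [LinearMap.sum_apply, AddSubmonoidClass.coe_finsetSum]
  refine Finset.sum_congr rfl fun j _ => ?_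
  rw [multiDeriv_add_single_nat _ _ _ hf, ← hu]
  have : D ^ j * (c • 1) ^ (k - j) * ((k.choose j : ℕ) : Module.End ℂ S) =
      ((k.choose j : ℂ) * c ^ (k - j)) • D ^ j := by
    rw [smul_pow, one_pow, mul_smul_comm, mul_one, ← Nat.cast_comm, ← nsmul_eq_mul, mul_smul,
      ← Nat.cast_smul_eq_nsmul ℂ]
  rw [this]
  change ((k.choose j : ℂ) * c ^ (k - j)) • ((D ^ j) ⟨u, hus⟩).1 = _
  rw [hD]

end Derivatives

/-! ### Associated functions of isotropic and log-convex sequences. -/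

section Weights

variable {n : ℕ}

/-- The associated function along the `i`-th coordinate axis. -/
noncomputable def WeightSequence.axial (A : WeightSequence n) (i : Fin n) (t : ℝ) : ℝ :=
  A.assoc (EuclideanSpace.single i t)

/-- The coordinate `i` guarantees that a multi-index of order `q` exists, namely `q e_i`. Without
one, `A` says nothing about `a q`. -/
theorem WeightSequence.IsIsotropic.pos {A : WeightSequence n} {a : ℕ → ℝ} (hA : A.IsIsotropic a)
    (i : Fin n) (q : ℕ) : 0 < a q := by
  have h := A.pos (Pi.single i q)
  rwa [hA, order_single] at h

theorem WeightSequence.IsIsotropic.zero {A : WeightSequence n} {a : ℕ → ℝ}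
    (hA : A.IsIsotropic a) : a 0 = 1 := by
  rw [← order_zero (n := n), ← hA, A.val_zero]

theorem WeightSequence.IsIsotropic.abs_pow_le {A : WeightSequence n} {a : ℕ → ℝ}
    (hA : A.IsIsotropic a) (x : EuclideanSpace ℝ (Fin n)) (i : Fin n) (q : ℕ) :
    |x i| ^ q ≤ a q * Real.exp (A.assoc x) := by
  have ha := hA.pos i q
  rcases (pow_nonneg (abs_nonneg (x i)) q).eq_or_lt with h0 | h0
  · rw [← h0]; positivity
  have h := le_ciSup (A.bddAbove x) (Pi.single i q)
  have hp : |∏ j, x j ^ (Pi.single i q : Fin n → ℕ) j| = |x i| ^ q := by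
    rw [Finset.prod_eq_single i]
    · simp [abs_pow]
    · intro j _ hj; simp [hj]
    · simp
  rw [hp, hA, order_single] at h
  change _ ≤ A.assoc x at h
  rw [← div_le_iff₀' ha]
  exact (Real.log_le_iff_le_exp (div_pos h0 ha)).1 h

/-- Since `|x^α| ≤ R ^ |α|` and the weight depends on `|α|` only, the supremum over multi-indices
reduces to one over `q`. Together with `abs_pow_le` this says that the associated function depends
only on the largest `|x_j|`. -/
theorem WeightSequence.IsIsotropic.exp_assoc_le {A : WeightSequence n} {a : ℕ → ℝ}
    (hA : A.IsIsotropic a) {x : EuclideanSpace ℝ (Fin n)} {R S : ℝ}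
    (hx : ∀ j, |x j| ≤ R) (hS : ∀ q, R ^ q ≤ a q * S) : Real.exp (A.assoc x) ≤ S := by
  have h1 : 1 ≤ S := by simpa [hA.zero] using hS 0
  rw [← Real.le_log_iff_exp_le (by linarith)]
  refine ciSup_le fun α => ?_
  rcases (abs_nonneg (∏ j, x j ^ α j)).eq_or_lt with h0 | h0
  · rw [← h0]; simpa using Real.log_nonneg h1
  refine Real.log_le_log (div_pos h0 (A.pos α)) ?_
  rw [div_le_iff₀' (A.pos α), hA]
  refine le_trans ?_ (hS _)
  rw [Finset.abs_prod, order, ← Finset.prod_pow_eq_pow_sum]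
  refine Finset.prod_le_prod (fun _ _ => abs_nonneg _) fun j _ => ?_
  rw [abs_pow]
  exact pow_le_pow_left₀ (abs_nonneg _) (hx j) _

theorem WeightSequence.axial_nonneg (A : WeightSequence n) (i : Fin n) (t : ℝ) :
    0 ≤ A.axial i t := A.assoc_nonneg _

theorem WeightSequence.axial_le_assoc (A : WeightSequence n) (i : Fin n) {t : ℝ}
    {x : EuclideanSpace ℝ (Fin n)} (h : |t| ≤ |x i|) : A.axial i t ≤ A.assoc x := by
  refine A.assoc_mono fun j => ?_
  by_cases hj : j = i
  · subst hj; simpa using h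
  · simp [hj]

theorem WeightSequence.axial_mono (A : WeightSequence n) (i : Fin n) {s t : ℝ} (hs : 0 ≤ s)
    (h : s ≤ t) : A.axial i s ≤ A.axial i t := by
  refine A.axial_le_assoc i ?_
  simpa [abs_of_nonneg hs, abs_of_nonneg (hs.trans h)] using h

theorem WeightSequence.IsIsotropic.pow_le_axial {A : WeightSequence n} {a : ℕ → ℝ}
    (hA : A.IsIsotropic a) (i : Fin n) {t : ℝ} (ht : 0 ≤ t) (q : ℕ) :
    t ^ q ≤ a q * Real.exp (A.axial i t) := by
  have h := hA.abs_pow_le (EuclideanSpace.single i t) i q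
  simp only [PiLp.single_apply, if_true, abs_of_nonneg ht] at h
  exact h

theorem WeightSequence.IsIsotropic.exp_axial_le {A : WeightSequence n} {a : ℕ → ℝ}
    (hA : A.IsIsotropic a) (i : Fin n) {t S : ℝ} (ht : 0 ≤ t)
    (hS : ∀ q, t ^ q ≤ a q * S) : Real.exp (A.axial i t) ≤ S := by
  refine hA.exp_assoc_le (R := t) (fun j => ?_) hS
  by_cases hj : j = i
  · subst hj; simp [abs_of_nonneg ht]
  · simp [hj, ht]

theorem WeightSequence.IsIsotropic.assoc_le_axial {A : WeightSequence n} {a : ℕ → ℝ}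
    (hA : A.IsIsotropic a) (i : Fin n) {x : EuclideanSpace ℝ (Fin n)} {R : ℝ} (hR : 0 ≤ R)
    (hx : ∀ j, |x j| ≤ R) : A.assoc x ≤ A.axial i R :=
  Real.exp_le_exp.1 (hA.exp_assoc_le hx (hA.pow_le_axial i hR))

/-- A substitute for subadditivity: each entry of the sum is at most twice the larger of `max |x_j|`
and `|t|`, and whichever is larger, the matching term on the right suffices because the other is
nonnegative. -/
theorem WeightSequence.IsIsotropic.assoc_add_le {A : WeightSequence n} {a : ℕ → ℝ}
    (hA : A.IsIsotropic a) (i : Fin n) (x : EuclideanSpace ℝ (Fin n)) (t : ℝ) :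
    A.assoc (x + EuclideanSpace.single i t) ≤
      A.assoc ((2 : ℝ) • x) + A.axial i (2 * |t|) := by
  obtain ⟨j, -, hj⟩ := Finset.exists_max_image Finset.univ (fun j => |x j|) ⟨i, Finset.mem_univ _⟩
  have hle : ∀ k, |(x + EuclideanSpace.single i t) k| ≤ 2 * max |x j| |t| := by
    intro k
    have h1 := hj k (Finset.mem_univ k)
    have h2 : |(EuclideanSpace.single i t : EuclideanSpace ℝ (Fin n)) k| ≤ |t| := by
      by_cases hk : k = i
      · subst hk; simp
      · simp [hk]
    have h3 := abs_add_le (x k) ((EuclideanSpace.single i t : EuclideanSpace ℝ (Fin n)) k)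
    have h4 := le_max_left |x j| |t|
    have h5 := le_max_right |x j| |t|
    simp only [PiLp.add_apply]
    linarith
  have h0 := A.assoc_nonneg ((2 : ℝ) • x)
  have h0' := A.axial_nonneg i (2 * |t|)
  rcases le_total |x j| |t| with h | h
  · rw [max_eq_right h] at hle
    linarith [hA.assoc_le_axial i (by positivity) hle]
  · rw [max_eq_left h] at hle
    have h1 := hA.assoc_le_axial j (by positivity) hle
    have h2 : A.axial j (2 * |x j|) ≤ A.assoc ((2 : ℝ) • x) :=
      A.axial_le_assoc j (by simp [abs_mul])
    linarith

theorem one_add_norm_pow_le (i : Fin n) (x : EuclideanSpace ℝ (Fin n)) (N : ℕ) :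
    (1 + ‖x‖) ^ N ≤ (1 + n : ℝ) ^ N * (1 + ∑ j, |x j| ^ N) := by
  obtain ⟨j, -, hj⟩ := Finset.exists_max_image Finset.univ (fun j => |x j|) ⟨i, Finset.mem_univ _⟩
  have h1 : ‖x‖ ≤ n * |x j| := by
    have h2 : x = ∑ k, EuclideanSpace.single k (x k) := by
      ext l
      simp [Finset.sum_apply, Pi.single_apply]
    calc ‖x‖ ≤ ∑ k, ‖EuclideanSpace.single k (x k)‖ := by
          conv_lhs => rw [h2]
          exact norm_sum_le _ _
      _ ≤ ∑ _k : Fin n, |x j| := by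
          refine Finset.sum_le_sum fun k _ => ?_
          simpa using hj k (Finset.mem_univ k)
      _ = n * |x j| := by simp
  have h3 : 1 + ‖x‖ ≤ (1 + n) * max 1 |x j| := by
    have := le_max_left 1 |x j|
    have h5 : (n : ℝ) * |x j| ≤ n * max 1 |x j| :=
      mul_le_mul_of_nonneg_left (le_max_right _ _) (by positivity)
    linarith
  refine (pow_le_pow_left₀ (by positivity) h3 N).trans ?_
  rw [mul_pow]
  refine mul_le_mul_of_nonneg_left ?_ (by positivity)
  have h6 : |x j| ^ N ≤ ∑ k, |x k| ^ N :=
    Finset.single_le_sum (f := fun k => |x k| ^ N) (fun k _ => by positivity) (Finset.mem_univ j)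
  have h7 : 0 ≤ |x j| ^ N := by positivity
  rcases le_total 1 |x j| with h | h
  · rw [max_eq_right h]; linarith
  · rw [max_eq_left h]; simp only [one_pow]; linarith

/-- The weights grow faster than every polynomial. -/
theorem WeightSequence.IsIsotropic.one_add_norm_pow_le_weight {A : WeightSequence n} {a : ℕ → ℝ}
    (hA : A.IsIsotropic a) (i : Fin n) (l : PosReal) (N : ℕ) :
    ∃ C : ℝ, 0 < C ∧ ∀ x, (1 + ‖x‖) ^ N ≤ C * A.weight l x := by
  have ha := hA.pos i N
  have hl := l.2
  refine ⟨(1 + n : ℝ) ^ N * (1 + ∑ _j : Fin n, (l : ℝ) ^ N * a N), by positivity, fun x => ?_⟩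
  refine (one_add_norm_pow_le i x N).trans ?_
  rw [mul_assoc]
  refine mul_le_mul_of_nonneg_left ?_ (by positivity)
  rw [add_mul, Finset.sum_mul]
  refine add_le_add ?_ (Finset.sum_le_sum fun j _ => ?_)
  · rw [one_mul]
    exact Real.one_le_exp (A.assoc_nonneg _)
  · have h := hA.abs_pow_le ((l : ℝ)⁻¹ • x) j N
    have h2 : |((l : ℝ)⁻¹ • x) j| = (l : ℝ)⁻¹ * |x j| := by
      simp [abs_mul, abs_of_pos hl]
    rw [h2, mul_pow, inv_pow, inv_mul_le_iff₀ (by positivity)] at h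
    rw [mul_assoc]
    exact h

theorem WeightSequence.one_le_weight (A : WeightSequence n) (l : PosReal)
    (x : EuclideanSpace ℝ (Fin n)) : 1 ≤ A.weight l x :=
  Real.one_le_exp (A.assoc_nonneg _)

/-- Midpoint convexity of the interpolating function between `q e_i` and `(q + 2) e_i`. -/
theorem WeightSequence.LogConvex.sq_le {A : WeightSequence n} {a : ℕ → ℝ} (hAc : A.LogConvex)
    (hA : A.IsIsotropic a) (i : Fin n) (q : ℕ) : a (q + 1) ^ 2 ≤ a q * a (q + 2) := by
  obtain ⟨F, hF, hFA⟩ := hAc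
  have hv : ∀ k : ℕ, F (fun j => ((Pi.single i k : Fin n → ℕ) j : ℝ)) = Real.log (a k) := by
    intro k; rw [hFA, hA, order_single]
  have hm : ∀ k : ℕ, (fun j => ((Pi.single i k : Fin n → ℕ) j : ℝ)) ∈ {x | ∀ j : Fin n, 0 ≤ x j} :=
    fun k j => Nat.cast_nonneg _
  have h := hF.2 (hm q) (hm (q + 2)) (show (0 : ℝ) ≤ 1 / 2 by norm_num)
    (show (0 : ℝ) ≤ 1 / 2 by norm_num) (by norm_num)
  have h2 : (1 / 2 : ℝ) • (fun j => ((Pi.single i q : Fin n → ℕ) j : ℝ)) +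
      (1 / 2 : ℝ) • (fun j => ((Pi.single i (q + 2) : Fin n → ℕ) j : ℝ)) =
      fun j => ((Pi.single i (q + 1) : Fin n → ℕ) j : ℝ) := by
    funext j
    by_cases hj : j = i
    · subst hj; simp; ring
    · simp [hj]
  rw [h2, hv, hv, hv] at h
  have h0 := hA.pos i q
  have h1 := hA.pos i (q + 1)
  have h3 := hA.pos i (q + 2)
  rw [← Real.log_le_log_iff (by positivity) (by positivity), Real.log_pow,
    Real.log_mul h0.ne' h3.ne']
  simp only [smul_eq_mul] at h
  push_cast
  linarith

theorem WeightSequence.LogConvex.ratio_mono {A : WeightSequence n} {a : ℕ → ℝ}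
    (hAc : A.LogConvex) (hA : A.IsIsotropic a) (i : Fin n) :
    Monotone fun q => a (q + 1) / a q := by
  refine monotone_nat_of_le_succ fun q => ?_
  rw [div_le_div_iff₀ (hA.pos i _) (hA.pos i _)]
  have := hAc.sq_le hA i q
  nlinarith

/-- The ratios `a (q + 1) / a q` increase and `a 0 = 1`, so extending from `j` by `k` factors gains
at least as much as starting from `0`. -/
theorem WeightSequence.LogConvex.mul_le {A : WeightSequence n} {a : ℕ → ℝ} (hAc : A.LogConvex)
    (hA : A.IsIsotropic a) (i : Fin n) (j k : ℕ) : a j * a k ≤ a (j + k) := by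
  induction k with
  | zero => simp [hA.zero]
  | succ k ih =>
    have h := hAc.ratio_mono hA i (show k ≤ j + k by omega)
    have hk := hA.pos i k
    have hjk := hA.pos i (j + k)
    have h1 := hA.pos i (k + 1)
    have h2 := hA.pos i (j + k + 1)
    simp only at h
    rw [div_le_div_iff₀ hk hjk] at h
    rw [← add_assoc]
    have h3 : a j * a (k + 1) * a k ≤ a (j + k + 1) * a k := by
      nlinarith [mul_le_mul_of_nonneg_right ih h1.le]
    exact le_of_mul_le_mul_right h3 hk

/-- The supremum in the associated function can be attained at any given index. -/
theorem WeightSequence.LogConvex.exists_pow_mul_le {A : WeightSequence n} {a : ℕ → ℝ}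
    (hAc : A.LogConvex) (hA : A.IsIsotropic a) (i : Fin n) (q : ℕ) :
    ∃ t : ℝ, 0 < t ∧ ∀ k, t ^ k * a q ≤ t ^ q * a k := by
  have hp := hA.pos i
  -- As the ratios increase, `t ^ k / a k` is nondecreasing up to `k = q` and nonincreasing from
  -- there on.
  set t := a (q + 1) / a q with ht
  have ht0 : 0 < t := div_pos (hp _) (hp _)
  have hup : ∀ k, q ≤ k → t * a k ≤ a (k + 1) := fun k hk => by
    rw [← le_div_iff₀ (hp k)]
    exact hAc.ratio_mono hA i hk
  have hdown : ∀ k, k ≤ q → a (k + 1) ≤ t * a k := fun k hk => by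
    rw [← div_le_iff₀ (hp k)]
    exact hAc.ratio_mono hA i hk
  refine ⟨t, ht0, fun k => ?_⟩
  rcases le_total q k with h | h
  · induction k, h using Nat.le_induction with
    | base => exact le_rfl
    | succ k hk ih =>
      have h1 := mul_le_mul_of_nonneg_left ih ht0.le
      have h2 := mul_le_mul_of_nonneg_left (hup k hk) (pow_pos ht0 q).le
      calc t ^ (k + 1) * a q = t * (t ^ k * a q) := by ring
        _ ≤ t * (t ^ q * a k) := h1
        _ = t ^ q * (t * a k) := by ring
        _ ≤ _ := h2
  · induction h using Nat.decreasingInduction with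
    | self => exact le_rfl
    | of_succ k hk ih =>
      have h2 := mul_le_mul_of_nonneg_left (hdown k hk.le) (pow_pos ht0 q).le
      refine le_of_mul_le_mul_left ?_ ht0
      calc t * (t ^ k * a q) = t ^ (k + 1) * a q := by ring
        _ ≤ t ^ q * a (k + 1) := ih
        _ ≤ t ^ q * (t * a k) := h2
        _ = t * (t ^ q * a k) := by ring

/-- Comparison of log-convex isotropic weight sequences through their associated functions. -/
theorem WeightSequence.LogConvex.dominated_of_axial_le {A B : WeightSequence n} {a b : ℕ → ℝ}
    (hAc : A.LogConvex) (hA : A.IsIsotropic a) (hB : B.IsIsotropic b) (i : Fin n)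
    {r s C T : ℝ} (hr : 0 < r) (hs : 0 < s)
    (h : ∀ t, T ≤ t → B.axial i (r * t) ≤ A.axial i (s * t) + C) :
    ∃ C H : ℝ, 0 < C ∧ 0 < H ∧ ∀ q, a q ≤ C * H ^ q * b q := by
  set D := max C (B.axial i (r * T)) with hD
  -- Enlarging the constant removes the threshold: on `[0, T]` the left side is at most its value at
  -- `T`.
  have hall : ∀ t, 0 ≤ t → B.axial i (r * t) ≤ A.axial i (s * t) + D := by
    intro t ht
    rcases le_total T t with hT | hT
    · linarith [h t hT, le_max_left C (B.axial i (r * T))]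
    · have h1 := B.axial_mono i (mul_nonneg hr.le ht) (mul_le_mul_of_nonneg_left hT hr.le)
      linarith [A.axial_nonneg i (s * t), le_max_right C (B.axial i (r * T))]
  refine ⟨Real.exp D, s / r, Real.exp_pos _, div_pos hs hr, fun q => ?_⟩
  -- At `u` the source supremum is attained at the index `q`. Comparing it with only the `q`-th term
  -- for `B` at `r * (u / s)` leaves `u ^ q` on both sides, and cancelling it gives the claim with
  -- `H = s / r`.
  obtain ⟨u, hu, hopt⟩ := hAc.exists_pow_mul_le hA i q
  have ha := hA.pos i q
  have hb := hB.pos i q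
  have h1 : Real.exp (A.axial i u) ≤ u ^ q / a q := by
    refine hA.exp_axial_le i hu.le fun k => ?_
    rw [mul_div_assoc', le_div_iff₀ ha, mul_comm (a k)]
    exact hopt k
  have h2 := hB.pow_le_axial i (t := r * (u / s)) (by positivity) q
  have h3 := Real.exp_le_exp.2 (hall (u / s) (by positivity))
  rw [mul_div_cancel₀ _ hs.ne', Real.exp_add] at h3
  have h4 : (r * (u / s)) ^ q ≤ b q * (u ^ q / a q * Real.exp D) :=
    h2.trans (mul_le_mul_of_nonneg_left
      (h3.trans (mul_le_mul_of_nonneg_right h1 (Real.exp_pos _).le)) hb.le)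
  have h5 : (r * (u / s)) ^ q = (r / s) ^ q * u ^ q := by rw [← mul_pow]; congr 1; ring
  have h6 : b q * (u ^ q / a q * Real.exp D) = (Real.exp D * b q / a q) * u ^ q := by ring
  rw [h5, h6] at h4
  have h7 := le_of_mul_le_mul_right h4 (pow_pos hu q)
  rw [le_div_iff₀ ha] at h7
  have h8 : (s / r) ^ q * (r / s) ^ q = 1 := by
    rw [← mul_pow]; field_simp; simp
  calc a q = (s / r) ^ q * ((r / s) ^ q * a q) := by rw [← mul_assoc, h8, one_mul]
    _ ≤ (s / r) ^ q * (Real.exp D * b q) := mul_le_mul_of_nonneg_left h7 (by positivity)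
    _ = _ := by ring

end Weights

/-! ### `L¹`, Fourier and supremum bounds by the step norms. -/

section Bounds

variable {n : ℕ}

theorem integrable_one_add_norm_pow_inv :
    Integrable (fun x : EuclideanSpace ℝ (Fin n) => ((1 + ‖x‖) ^ (n + 1))⁻¹) := by
  have h := integrable_one_add_norm (E := EuclideanSpace ℝ (Fin n)) (μ := volume)
    (r := ((n + 1 : ℕ) : ℝ)) (by simp)
  refine h.congr (Eventually.of_forall fun x => ?_)
  simp only
  rw [Real.rpow_neg (by positivity), Real.rpow_natCast]

theorem WeightSequence.IsIsotropic.memLp_weight_inv {A : WeightSequence n} {a : ℕ → ℝ}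
    (hA : A.IsIsotropic a) (i : Fin n) (l : PosReal) {q : ℝ≥0∞} (hq : 1 ≤ q) :
    MemLp (fun x => (A.weight l x)⁻¹) q volume := by
  have hm : AEStronglyMeasurable (fun x => (A.weight l x)⁻¹) volume :=
    (A.measurable_weight l).inv.aestronglyMeasurable
  have h1 : ∀ x, ‖(A.weight l x)⁻¹‖ ≤ 1 := fun x => by
    rw [Real.norm_of_nonneg (inv_nonneg.2 (A.weight_pos l x).le)]
    exact inv_le_one_of_one_le₀ (A.one_le_weight l x)
  rcases eq_or_ne q ⊤ with rfl | hq'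
  · exact memLp_top_of_bound hm 1 (Eventually.of_forall h1)
  · rw [← integrable_norm_rpow_iff hm (by positivity) hq']
    obtain ⟨C, hC, hCw⟩ := hA.one_add_norm_pow_le_weight i l (n + 1)
    have hq1 : 1 ≤ q.toReal := by
      rw [← ENNReal.toReal_one]; exact ENNReal.toReal_mono hq' hq
    refine (integrable_one_add_norm_pow_inv.const_mul C).mono' ?_ (Eventually.of_forall fun x => ?_)
    · exact ((A.measurable_weight l).inv.norm.pow_const _).aestronglyMeasurable
    · rw [Real.norm_of_nonneg (by positivity)]
      -- The inverse weight is at most `1`, so a power with exponent at least `1` only decreases it.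
      -- The polynomial bound for the first power thus serves every finite exponent.
      refine (Real.rpow_le_rpow_of_exponent_ge' (norm_nonneg _) (h1 x) zero_le_one hq1).trans ?_
      rw [Real.rpow_one, Real.norm_of_nonneg (inv_nonneg.2 (A.weight_pos l x).le)]
      rw [inv_le_iff_one_le_mul₀ (A.weight_pos l x), mul_comm C, mul_assoc,
        ← div_eq_inv_mul, one_le_div (by positivity)]
      exact hCw x

/-- Hölder's inequality for the product of the inverse weight, which lies in every `L^q`, with the
weighted function. This removes the dependence on `p` from the later arguments. -/
theorem WeightSequence.IsIsotropic.exists_eLpNorm_one_le {A : WeightSequence n} {a : ℕ → ℝ}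
    (hA : A.IsIsotropic a) (i : Fin n) (l : PosReal) (p : ℝ≥0∞) [Fact (1 ≤ p)] :
    ∃ C : ℝ≥0∞, C ≠ ⊤ ∧ ∀ h : EuclideanSpace ℝ (Fin n) → ℂ, Continuous h →
      eLpNorm h 1 volume ≤ C * eLpNorm (fun x => A.weight l x • h x) p volume := by
  have hq : (1 : ℝ≥0∞) ≤ p.conjExponent := by
    rw [ENNReal.conjExponent]; exact le_self_add
  have hm := hA.memLp_weight_inv i l hq
  have : ENNReal.HolderTriple p.conjExponent p 1 :=
    (ENNReal.HolderConjugate.conjExponent (p := p) Fact.out).symm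
  refine ⟨_, hm.eLpNorm_ne_top, fun h hh => ?_⟩
  have h1 : h = (fun x => (A.weight l x)⁻¹) • fun x => A.weight l x • h x := by
    funext x
    simp only [Pi.smul_apply', smul_smul, inv_mul_cancel₀ (A.weight_pos l x).ne', one_smul]
  conv_lhs => rw [h1]
  exact eLpNorm_smul_le_mul_eLpNorm
    ((A.measurable_weight l).smul hh.measurable).aestronglyMeasurable hm.1

theorem eLpNorm_le_eNorm_mul (p : ℝ≥0∞) (M : WeightSequence n)
    (w : EuclideanSpace ℝ (Fin n) → ℝ) (f : EuclideanSpace ℝ (Fin n) → ℂ) (α : Fin n → ℕ) :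
    eLpNorm (fun x => w x • multiDeriv α f x) p volume ≤
      eNorm p M w f * ENNReal.ofReal (M.val α) := by
  have h0 : ENNReal.ofReal (M.val α) ≠ 0 := by simpa using M.pos α
  rw [← ENNReal.div_le_iff h0 ENNReal.ofReal_ne_top]
  exact le_iSup (fun α => eLpNorm (fun x => w x • multiDeriv α f x) p volume /
    ENNReal.ofReal (M.val α)) α

theorem eNorm_le_iff {p : ℝ≥0∞} {M : WeightSequence n}
    {w : EuclideanSpace ℝ (Fin n) → ℝ} {f : EuclideanSpace ℝ (Fin n) → ℂ} {K : ℝ≥0∞} :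
    eNorm p M w f ≤ K ↔ ∀ α, eLpNorm (fun x => w x • multiDeriv α f x) p volume ≤
      K * ENNReal.ofReal (M.val α) := by
  simp only [eNorm, iSup_le_iff]
  refine forall_congr' fun α => ?_
  have h0 : ENNReal.ofReal (M.val α) ≠ 0 := by simpa using M.pos α
  rw [ENNReal.div_le_iff h0 ENNReal.ofReal_ne_top]

/-- The `L¹` norms of the derivatives are controlled by the norm of the step. -/
theorem WeightSequence.IsIsotropic.exists_integral_norm_le {A : WeightSequence n} {a : ℕ → ℝ}
    (hA : A.IsIsotropic a) (i : Fin n) (l : PosReal) (p : ℝ≥0∞) [Fact (1 ≤ p)] :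
    ∃ C : ℝ, 0 ≤ C ∧ ∀ (M : WeightSequence n), ∀ f ∈ stepSpace p M (A.weight l), ∀ α,
      Integrable (multiDeriv α f) ∧
      ∫ x, ‖multiDeriv α f x‖ ≤ C * ((eNorm p M (A.weight l) f).toReal * M.val α) := by
  obtain ⟨C, hC, h⟩ := hA.exists_eLpNorm_one_le i l p
  refine ⟨C.toReal, ENNReal.toReal_nonneg, fun M f hf α => ?_⟩
  have hc := (multiDeriv_contDiff α hf.1).continuous
  have h1 := h _ hc
  have h2 : eLpNorm (multiDeriv α f) 1 volume ≤
      C * (eNorm p M (A.weight l) f * ENNReal.ofReal (M.val α)) :=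
    h1.trans (mul_le_mul_right (eLpNorm_le_eNorm_mul p M _ f α) C)
  have hfin : C * (eNorm p M (A.weight l) f * ENNReal.ofReal (M.val α)) ≠ ⊤ :=
    ENNReal.mul_ne_top hC (ENNReal.mul_ne_top hf.2.2.ne ENNReal.ofReal_ne_top)
  have hint : Integrable (multiDeriv α f) :=
    memLp_one_iff_integrable.1 ⟨hc.aestronglyMeasurable, h2.trans_lt hfin.lt_top⟩
  refine ⟨hint, ?_⟩
  rw [integral_norm_eq_lintegral_enorm hc.aestronglyMeasurable, ← eLpNorm_one_eq_lintegral_enorm]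
  refine (ENNReal.toReal_mono hfin h2).trans_eq ?_
  rw [ENNReal.toReal_mul, ENNReal.toReal_mul, ENNReal.toReal_ofReal (M.pos α).le]

open scoped FourierTransform

theorem norm_fourier_le_integral_norm (f : EuclideanSpace ℝ (Fin n) → ℂ)
    (ξ : EuclideanSpace ℝ (Fin n)) : ‖𝓕 f ξ‖ ≤ ∫ x, ‖f x‖ := by
  rw [Real.fourier_eq]
  refine (norm_integral_le_integral_norm _).trans_eq ?_
  simp only [Circle.norm_smul]

/-- Integration by parts against the character. Integrability of `f` and of `∂_i f` suffices, since
the character is bounded together with its derivative. -/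
theorem fourier_partialDeriv (i : Fin n) {f : EuclideanSpace ℝ (Fin n) → ℂ}
    (hf : ContDiff ℝ ∞ f) (hi : Integrable f) (hi' : Integrable (partialDeriv i f))
    (ξ : EuclideanSpace ℝ (Fin n)) :
    𝓕 (partialDeriv i f) ξ = (2 * Real.pi * ξ i * Complex.I) * 𝓕 f ξ := by
  rw [Real.fourier_eq', Real.fourier_eq']
  set c : EuclideanSpace ℝ (Fin n) → ℂ :=
    fun x => Complex.exp (((-2 * Real.pi * inner ℝ x ξ : ℝ) : ℂ) * Complex.I) with hc
  have hcs : ContDiff ℝ ∞ c := by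
    refine Complex.contDiff_exp.comp (ContDiff.mul ?_ contDiff_const)
    refine Complex.ofRealCLM.contDiff.comp (contDiff_const.mul ?_)
    exact contDiff_id.inner ℝ contDiff_const
  have hc1 : ∀ x, ‖c x‖ = 1 := fun x => Complex.norm_exp_ofReal_mul_I _
  have hcd : ∀ x, fderiv ℝ c x (EuclideanSpace.single i 1) =
      -(2 * Real.pi * ξ i * Complex.I) * c x := by
    intro x
    have h1 : HasFDerivAt (fun x : EuclideanSpace ℝ (Fin n) =>
        ((-2 * Real.pi * inner ℝ x ξ : ℝ) : ℂ) * Complex.I)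
        (((Complex.ofRealCLM ∘L ((-2 * Real.pi) • innerSL ℝ ξ))).smulRight Complex.I) x := by
      have h2 : HasFDerivAt (fun x : EuclideanSpace ℝ (Fin n) => inner ℝ x ξ) (innerSL ℝ ξ) x := by
        have := (innerSL ℝ ξ).hasFDerivAt (x := x)
        simpa [real_inner_comm] using this
      exact ((Complex.ofRealCLM.hasFDerivAt.comp x (h2.const_mul (-2 * Real.pi)))).mul_const'
        Complex.I
    have h3 := h1.cexp
    rw [hc, h3.fderiv]
    simp [EuclideanSpace.inner_single_right]
    ring
  have key : ∫ x, c x * partialDeriv i f x = -∫ x, fderiv ℝ c x (EuclideanSpace.single i 1) * f x := by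
    refine integral_mul_fderiv_eq_neg_fderiv_mul_of_integrable ?_ ?_ ?_
      (fun x _ => hcs.differentiable (by simp) x) (fun x _ => hf.differentiable (by simp) x)
    · simp only [hcd, mul_assoc]
      refine Integrable.const_mul ?_ _
      exact hi.bdd_mul hcs.continuous.aestronglyMeasurable (c := 1)
        (Eventually.of_forall fun x => (hc1 x).le)
    · exact hi'.bdd_mul hcs.continuous.aestronglyMeasurable (c := 1)
        (Eventually.of_forall fun x => (hc1 x).le)
    · exact hi.bdd_mul hcs.continuous.aestronglyMeasurable (c := 1)
        (Eventually.of_forall fun x => (hc1 x).le)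
  change ∫ x, c x * partialDeriv i f x = _ * ∫ x, c x * f x
  rw [key, ← integral_const_mul, ← integral_neg]
  refine integral_congr_ae (Eventually.of_forall fun x => ?_)
  simp only [hcd]
  ring

theorem abs_pow_mul_norm_fourier_le (i : Fin n) (k : ℕ) {f : EuclideanSpace ℝ (Fin n) → ℂ}
    (hf : ContDiff ℝ ∞ f) (hi : ∀ j ≤ k, Integrable ((partialDeriv i)^[j] f))
    (ξ : EuclideanSpace ℝ (Fin n)) :
    (2 * Real.pi * |ξ i|) ^ k * ‖𝓕 f ξ‖ ≤ ∫ x, ‖(partialDeriv i)^[k] f x‖ := by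
  have h1 : ∀ j ≤ k, 𝓕 ((partialDeriv i)^[j] f) ξ = (2 * Real.pi * ξ i * Complex.I) ^ j * 𝓕 f ξ := by
    intro j hj
    induction j with
    | zero => simp
    | succ j ih =>
      have h := hi (j + 1) hj
      rw [Function.iterate_succ_apply'] at h ⊢
      rw [fourier_partialDeriv i (partialDeriv_iterate_contDiff i j hf) (hi j (by omega)) h,
        ih (by omega)]
      ring
  have h2 : ‖𝓕 ((partialDeriv i)^[k] f) ξ‖ ≤ ∫ x, ‖(partialDeriv i)^[k] f x‖ :=
    norm_fourier_le_integral_norm _ ξ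
  rw [h1 k le_rfl, norm_mul, norm_pow] at h2
  convert h2 using 3
  simp [abs_of_pos Real.pi_pos]

/-- A Sobolev type embedding: the supremum norm is controlled by `L¹` norms of derivatives. -/
theorem exists_norm_le_integral_norm (i₀ : Fin n) :
    ∃ C : ℝ, 0 ≤ C ∧ ∀ f : EuclideanSpace ℝ (Fin n) → ℂ, ContDiff ℝ ∞ f →
      (∀ i k, Integrable ((partialDeriv i)^[k] f)) →
      ∀ x, ‖f x‖ ≤ C * ((∫ y, ‖f y‖) + ∑ i, ∫ y, ‖(partialDeriv i)^[n + 1] f y‖) := by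
  set J : ℝ := ∫ ξ : EuclideanSpace ℝ (Fin n), ((1 + ‖ξ‖) ^ (n + 1))⁻¹ with hJ
  have hJ0 : 0 ≤ J := integral_nonneg fun ξ => by positivity
  refine ⟨J * (1 + n : ℝ) ^ (n + 1), by positivity, fun f hf hi x => ?_⟩
  have hif : Integrable f := hi i₀ 0
  set D : ℝ := (∫ y, ‖f y‖) + ∑ i, ∫ y, ‖(partialDeriv i)^[n + 1] f y‖ with hD
  -- Taking `n + 1` derivatives along each axis makes the Fourier transform decay like an integrable
  -- function. Fourier inversion then bounds the supremum of `f` by the `L¹` norm of its transform.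
  have hdecay : ∀ ξ, ‖𝓕 f ξ‖ ≤ ((1 + n : ℝ) ^ (n + 1) * D) * ((1 + ‖ξ‖) ^ (n + 1))⁻¹ := by
    intro ξ
    rw [← div_eq_mul_inv, le_div_iff₀' (by positivity)]
    refine (mul_le_mul_of_nonneg_right (one_add_norm_pow_le i₀ ξ (n + 1)) (norm_nonneg _)).trans ?_
    rw [mul_assoc]
    refine mul_le_mul_of_nonneg_left ?_ (by positivity)
    rw [add_mul, one_mul, Finset.sum_mul]
    refine add_le_add (norm_fourier_le_integral_norm f ξ)
      (Finset.sum_le_sum fun i _ => ?_)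
    refine le_trans ?_ (abs_pow_mul_norm_fourier_le i (n + 1) hf (fun j _ => hi i j) ξ)
    refine mul_le_mul_of_nonneg_right (pow_le_pow_left₀ (abs_nonneg _) ?_ _) (norm_nonneg _)
    have := Real.pi_gt_three
    nlinarith [abs_nonneg (ξ i)]
  have hcont : Continuous (𝓕 f) :=
    VectorFourier.fourierIntegral_continuous Real.continuous_fourierChar
      (by simpa using continuous_inner) hif
  have hint : Integrable (𝓕 f) :=
    (integrable_one_add_norm_pow_inv.const_mul ((1 + n : ℝ) ^ (n + 1) * D)).mono'
      hcont.aestronglyMeasurable (Eventually.of_forall hdecay)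
  have hinv := congrFun (hf.continuous.fourierInv_fourier_eq hif hint) x
  rw [← hinv]
  have h1 : ‖𝓕⁻ (𝓕 f) x‖ ≤ ∫ ξ, ‖𝓕 f ξ‖ := by
    rw [Real.fourierInv_eq_fourier_neg]
    exact norm_fourier_le_integral_norm _ _
  refine h1.trans ?_
  refine (integral_mono hint.norm (integrable_one_add_norm_pow_inv.const_mul _) hdecay).trans_eq ?_
  rw [integral_const_mul, ← hJ]
  ring

/-- A vanishing transform is integrable, so the inversion formula applies to it and returns `f = 0`.
-/
theorem exists_fourier_ne_zero {f : EuclideanSpace ℝ (Fin n) → ℂ} (hf : Continuous f)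
    (hi : Integrable f) (h0 : f ≠ 0) : ∃ ξ, 𝓕 f ξ ≠ 0 := by
  by_contra! h
  have h1 : 𝓕 f = 0 := funext h
  have h2 := hf.fourierInv_fourier_eq hi (by rw [h1]; exact integrable_zero _ _ _)
  apply h0
  rw [← h2, h1]
  funext x
  simp [Real.fourierInv_eq]

/-- The suprema of the derivatives are controlled by the norm of the step. -/
theorem WeightSequence.IsIsotropic.exists_norm_multiDeriv_le {A : WeightSequence n} {a : ℕ → ℝ}
    (hA : A.IsIsotropic a) (i : Fin n) (M : WeightSequence n) (l : PosReal) (p : ℝ≥0∞)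
    [Fact (1 ≤ p)] (α : Fin n → ℕ) :
    ∃ C : ℝ, 0 ≤ C ∧ ∀ f ∈ stepSpace p M (A.weight l), ∀ x,
      ‖multiDeriv α f x‖ ≤ C * (eNorm p M (A.weight l) f).toReal := by
  obtain ⟨C, hC, h⟩ := hA.exists_integral_norm_le i l p
  obtain ⟨D, hD, hs⟩ := exists_norm_le_integral_norm i
  have hM := M.pos
  refine ⟨D * (C * M.val α + ∑ j, C * M.val (α + Pi.single j (n + 1))),
    mul_nonneg hD (add_nonneg (mul_nonneg hC (hM _).le)
      (Finset.sum_nonneg fun j _ => mul_nonneg hC (hM _).le)), fun f hf x => ?_⟩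
  have h1 := hs (multiDeriv α f) (multiDeriv_contDiff α hf.1) (fun j k => by
    rw [← multiDeriv_add_single_nat α j k hf.1]
    exact (h M f hf _).1) x
  refine h1.trans ?_
  rw [mul_assoc]
  refine mul_le_mul_of_nonneg_left ?_ hD
  rw [add_mul, Finset.sum_mul]
  refine add_le_add ?_ (Finset.sum_le_sum fun j _ => ?_)
  · refine (h M f hf α).2.trans_eq (by ring)
  · rw [← multiDeriv_add_single_nat α j _ hf.1]
    refine (h M f hf _).2.trans_eq (by ring)

end Bounds

/-! ### Absolutely convergent combinations and uniform boundedness on `ℓ¹`. -/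

section Series

variable {n : ℕ}

theorem norm_fderiv_le_sum_partialDeriv (f : EuclideanSpace ℝ (Fin n) → ℂ)
    (x : EuclideanSpace ℝ (Fin n)) : ‖fderiv ℝ f x‖ ≤ ∑ i, ‖partialDeriv i f x‖ := by
  refine ContinuousLinearMap.opNorm_le_bound _ (Finset.sum_nonneg fun i _ => norm_nonneg _)
    fun v => ?_
  have h2 : v = ∑ k, v k • EuclideanSpace.single k (1 : ℝ) := by
    ext l
    simp [Finset.sum_apply, Pi.single_apply]
  conv_lhs => rw [h2]
  rw [map_sum, Finset.sum_mul]
  refine (norm_sum_le _ _).trans (Finset.sum_le_sum fun i _ => ?_)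
  rw [map_smul, norm_smul, mul_comm]
  exact mul_le_mul_of_nonneg_left (PiLp.norm_apply_le v i) (norm_nonneg _)

theorem fderiv_apply_eq_sum_partialDeriv (f : EuclideanSpace ℝ (Fin n) → ℂ)
    (x v : EuclideanSpace ℝ (Fin n)) : fderiv ℝ f x v = ∑ i, v i • partialDeriv i f x := by
  have h2 : v = ∑ k, v k • EuclideanSpace.single k (1 : ℝ) := by
    ext l
    simp [Finset.sum_apply, Pi.single_apply]
  conv_lhs => rw [h2]
  rw [map_sum]
  simp only [map_smul]
  rfl

/-- A family of differentiable functions closed under partial derivatives is the family of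
derivatives of a smooth function. -/
theorem multiDeriv_of_family {S : (Fin n → ℕ) → EuclideanSpace ℝ (Fin n) → ℂ}
    (hd : ∀ α, Differentiable ℝ (S α))
    (hp : ∀ α i, partialDeriv i (S α) = S (α + Pi.single i 1)) :
    ContDiff ℝ ∞ (S 0) ∧ ∀ α, multiDeriv α (S 0) = S α := by
  -- The induction on `k` runs over all `α` at once: the differential of `S α` is a combination of
  -- the neighbours `S (α + e_i)`.
  have hc : ∀ (k : ℕ) α, ContDiff ℝ k (S α) := by
    intro k
    induction k with
    | zero => intro α; exact contDiff_zero.2 (hd α).continuous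
    | succ k ih =>
      intro α
      rw [Nat.cast_succ, contDiff_succ_iff_fderiv_apply]
      refine ⟨hd α, by simp, fun v => ?_⟩
      simp only [fderiv_apply_eq_sum_partialDeriv, hp]
      exact ContDiff.sum fun i _ => (ih _).const_smul (v i)
  have h0 : ContDiff ℝ ∞ (S 0) := contDiff_infty.2 fun k => hc k 0
  refine ⟨h0, fun α => ?_⟩
  induction α using multiIndex_induction with
  | h0 => exact multiDeriv_zero_index _
  | hs α i ih => rw [multiDeriv_add_single _ _ h0, ih, hp]

variable {p : ℝ≥0∞} [Fact (1 ≤ p)] {A M : WeightSequence n} {a : ℕ → ℝ} {l : PosReal}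
  {g : ℕ → EuclideanSpace ℝ (Fin n) → ℂ} {K : ℝ≥0∞}

theorem WeightSequence.IsIsotropic.exists_norm_multiDeriv_le_of_bounded (hA : A.IsIsotropic a)
    (i : Fin n) (hg : ∀ j, g j ∈ stepSpace p M (A.weight l)) (hK : K ≠ ⊤)
    (hgK : ∀ j, eNorm p M (A.weight l) (g j) ≤ K) (α : Fin n → ℕ) :
    ∃ C : ℝ, 0 ≤ C ∧ ∀ j x, ‖multiDeriv α (g j) x‖ ≤ C := by
  obtain ⟨C, hC, h⟩ := hA.exists_norm_multiDeriv_le i M l p α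
  refine ⟨C * K.toReal, mul_nonneg hC ENNReal.toReal_nonneg, fun j x => ?_⟩
  exact (h _ (hg j) x).trans (mul_le_mul_of_nonneg_left (ENNReal.toReal_mono hK (hgK j)) hC)

theorem summable_mul_of_bounded {c u : ℕ → ℂ} (hc : Summable fun j => ‖c j‖) {C : ℝ}
    (hu : ∀ j, ‖u j‖ ≤ C) : Summable fun j => c j * u j := by
  refine Summable.of_norm_bounded (hc.mul_right C) fun j => ?_
  rw [norm_mul]
  exact mul_le_mul_of_nonneg_left (hu j) (norm_nonneg _)

theorem _root_.ContinuousLinearMap.tsum_apply {E F : Type*} [NormedAddCommGroup E]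
    [NormedSpace ℝ E] [NormedAddCommGroup F] [NormedSpace ℝ F] {f : ℕ → E →L[ℝ] F}
    (hf : Summable f) (v : E) : (∑' j, f j) v = ∑' j, f j v :=
  (hf.hasSum.mapL (ContinuousLinearMap.apply ℝ F v)).tsum_eq.symm

/-- Termwise differentiation of absolutely convergent combinations of a bounded sequence. -/
theorem WeightSequence.IsIsotropic.multiDeriv_tsum (hA : A.IsIsotropic a)
    (i : Fin n) (hg : ∀ j, g j ∈ stepSpace p M (A.weight l)) (hK : K ≠ ⊤)
    (hgK : ∀ j, eNorm p M (A.weight l) (g j) ≤ K) {c : ℕ → ℂ} (hc : Summable fun j => ‖c j‖) :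
    ContDiff ℝ ∞ (fun x => ∑' j, c j * g j x) ∧ ∀ α,
      multiDeriv α (fun x => ∑' j, c j * g j x) = fun x => ∑' j, c j * multiDeriv α (g j) x := by
  have hbd := hA.exists_norm_multiDeriv_le_of_bounded i hg hK hgK
  have key : ∀ α x, HasFDerivAt (fun x => ∑' j, c j * multiDeriv α (g j) x)
      (∑' j, c j • fderiv ℝ (multiDeriv α (g j)) x) x ∧
      Summable fun j => c j • fderiv ℝ (multiDeriv α (g j)) x := by
    intro α x
    choose C hC0 hC using fun k : Fin n => hbd (α + Pi.single k 1)
    obtain ⟨C', -, hC'⟩ := hbd α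
    -- Uniform bounds on the derivatives one order higher make the series of differentials normally
    -- convergent.
    have hf' : ∀ j x, ‖c j • fderiv ℝ (multiDeriv α (g j)) x‖ ≤ ‖c j‖ * ∑ k, C k := by
      intro j x
      rw [norm_smul]
      refine mul_le_mul_of_nonneg_left ?_ (norm_nonneg _)
      refine (norm_fderiv_le_sum_partialDeriv _ x).trans (Finset.sum_le_sum fun k _ => ?_)
      rw [← multiDeriv_add_single α k (hg j).1]
      exact hC k j x
    have hu : Summable fun j => ‖c j‖ * ∑ k, C k := hc.mul_right _
    have hsum : Summable fun j => c j • fderiv ℝ (multiDeriv α (g j)) x :=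
      .of_norm_bounded hu fun j => hf' j x
    have hder : ∀ j y, HasFDerivAt (fun x => c j * multiDeriv α (g j) x)
        (c j • fderiv ℝ (multiDeriv α (g j)) y) y := fun j y =>
      (((multiDeriv_contDiff α (hg j).1).differentiable (by simp)) y).hasFDerivAt.const_mul _
    have hpt : Summable fun j => c j * multiDeriv α (g j) x :=
      summable_mul_of_bounded hc fun j => hC' j x
    exact ⟨hasFDerivAt_tsum hu hder hf' hpt x, hsum⟩
  refine (multiDeriv_of_family (S := fun α x => ∑' j, c j * multiDeriv α (g j) x)
    (fun α x => (key α x).1.differentiableAt) fun α k => ?_).imp ?_ ?_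
  · funext x
    rw [partialDeriv, (key α x).1.fderiv]
    rw [ContinuousLinearMap.tsum_apply (key α x).2]
    refine tsum_congr fun j => ?_
    rw [multiDeriv_add_single α k (hg j).1]
    rfl
  · simp only [multiDeriv_zero_index, imp_self]
  · simp only [multiDeriv_zero_index, imp_self]

/-- Absolutely convergent combinations of a bounded sequence of a step stay in the step. -/
theorem WeightSequence.IsIsotropic.tsum_mem_stepSpace (hA : A.IsIsotropic a)
    (i : Fin n) (hg : ∀ j, g j ∈ stepSpace p M (A.weight l)) (hK : K ≠ ⊤)
    (hgK : ∀ j, eNorm p M (A.weight l) (g j) ≤ K) {c : ℕ → ℂ} (hc : Summable fun j => ‖c j‖) :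
    (fun x => ∑' j, c j * g j x) ∈ stepSpace p M (A.weight l) ∧
      eNorm p M (A.weight l) (fun x => ∑' j, c j * g j x) ≤
        ENNReal.ofReal (∑' j, ‖c j‖) * K := by
  obtain ⟨hs, hd⟩ := hA.multiDeriv_tsum i hg hK hgK hc
  set F : EuclideanSpace ℝ (Fin n) → ℂ := fun x => ∑' j, c j * g j x with hF
  have hle : ∀ α, eLpNorm (fun x => A.weight l x • multiDeriv α F x) p volume ≤
      ENNReal.ofReal (∑' j, ‖c j‖) * K * ENNReal.ofReal (M.val α) := by
    intro α
    obtain ⟨C, -, hC⟩ := hA.exists_norm_multiDeriv_le_of_bounded i hg hK hgK α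
    have hm : ∀ j, AEStronglyMeasurable (c j • fun x => A.weight l x • multiDeriv α (g j) x)
        volume := fun j => ((hg j).2.1 α).1.const_smul _
    -- Fatou's lemma for the pointwise limit of the partial sums, whose norms the triangle
    -- inequality controls. No completeness of the step is used.
    have hlim := Lp.eLpNorm_lim_le_liminf_eLpNorm (p := p) (μ := volume)
      (f := fun N => ∑ j ∈ Finset.range N, c j • fun x => A.weight l x • multiDeriv α (g j) x)
      (fun N => Finset.aestronglyMeasurable_sum _ fun j _ => hm j)
      (fun x => A.weight l x • multiDeriv α F x) (Eventually.of_forall fun x => by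
        have h1 := (summable_mul_of_bounded hc fun j => hC j x).hasSum.tendsto_sum_nat
        have h2 := h1.const_smul (A.weight l x)
        rw [hd α]
        convert h2 using 2 with N
        simp only [Finset.sum_apply, Pi.smul_apply, smul_eq_mul, Finset.smul_sum]
        refine Finset.sum_congr rfl fun j _ => ?_
        rw [mul_smul_comm])
    refine hlim.trans (liminf_le_of_frequently_le' (Frequently.of_forall fun N => ?_))
    refine (eLpNorm_sum_le (fun j _ => hm j) Fact.out).trans ?_
    calc ∑ j ∈ Finset.range N, eLpNorm (c j • fun x => A.weight l x • multiDeriv α (g j) x) p volume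
        ≤ ∑ j ∈ Finset.range N, ENNReal.ofReal ‖c j‖ * (K * ENNReal.ofReal (M.val α)) := by
          refine Finset.sum_le_sum fun j _ => ?_
          rw [eLpNorm_const_smul, ← ofReal_norm]
          refine mul_le_mul_right ?_ _
          exact (eLpNorm_le_eNorm_mul p M _ _ α).trans (mul_le_mul_left (hgK j) _)
      _ = ENNReal.ofReal (∑ j ∈ Finset.range N, ‖c j‖) * (K * ENNReal.ofReal (M.val α)) := by
          rw [← Finset.sum_mul, ENNReal.ofReal_sum_of_nonneg fun j _ => norm_nonneg _]
      _ ≤ ENNReal.ofReal (∑' j, ‖c j‖) * (K * ENNReal.ofReal (M.val α)) := by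
          refine mul_le_mul_left (ENNReal.ofReal_le_ofReal ?_) _
          exact hc.sum_le_tsum _ fun j _ => norm_nonneg _
      _ = _ := by rw [mul_assoc]
  have hfin : ENNReal.ofReal (∑' j, ‖c j‖) * K < ⊤ :=
    ENNReal.mul_lt_top ENNReal.ofReal_lt_top hK.lt_top
  have hn := eNorm_le_iff.2 hle
  refine ⟨⟨hs, fun α => ⟨?_, (hle α).trans_lt (ENNReal.mul_lt_top hfin ENNReal.ofReal_lt_top)⟩,
    hn.trans_lt hfin⟩, hn⟩
  exact ((A.measurable_weight l).smul
    (multiDeriv_contDiff α hs).continuous.measurable).aestronglyMeasurable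

theorem summable_norm_lp_one (c : lp (fun _ : ℕ => ℂ) 1) : Summable fun j => ‖c j‖ := by
  simpa using (lp.memℓp c).summable (by simp)

theorem norm_lp_one_eq_tsum (c : lp (fun _ : ℕ => ℂ) 1) : ‖c‖ = ∑' j, ‖c j‖ := by
  simpa using lp.norm_eq_tsum_rpow (by simp) c

/-- The uniform boundedness principle for functionals applied to a bounded sequence, when they
are bounded on each absolutely convergent combination of the sequence. -/
theorem WeightSequence.IsIsotropic.exists_bound_of_pointwise (hA : A.IsIsotropic a)
    (i : Fin n) (hg : ∀ j, g j ∈ stepSpace p M (A.weight l)) (hK : K ≠ ⊤)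
    (hgK : ∀ j, eNorm p M (A.weight l) (g j) ≤ K)
    {ψ : ℕ → EuclideanSpace ℝ (Fin n) → ℂ} (hψ : ∀ j, Measurable (ψ j)) {D : ℕ → ℝ}
    (hD : ∀ j x, ‖ψ j x‖ ≤ D j)
    (hb : ∀ c : ℕ → ℂ, (Summable fun j => ‖c j‖) →
      ∃ C : ℝ, ∀ j, ‖∫ x, (∑' k, c k * g k x) * ψ j x‖ ≤ C) :
    ∃ C : ℝ, ∀ j, ‖∫ x, g j x * ψ j x‖ ≤ C := by
  have hsum : ∀ (c : lp (fun _ : ℕ => ℂ) 1) x, Summable fun j => c j * g j x := by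
    intro c x
    obtain ⟨C, -, hC⟩ := hA.exists_norm_multiDeriv_le_of_bounded i hg hK hgK 0
    simp only [multiDeriv_zero_index] at hC
    exact summable_mul_of_bounded (summable_norm_lp_one c) fun j => hC j x
  obtain ⟨C₁, hC₁, hL1⟩ := hA.exists_integral_norm_le i l p
  let F : lp (fun _ : ℕ => ℂ) 1 → EuclideanSpace ℝ (Fin n) → ℂ := fun c x => ∑' j, c j * g j x
  have hmem := fun c : lp (fun _ : ℕ => ℂ) 1 =>
    hA.tsum_mem_stepSpace i hg hK hgK (summable_norm_lp_one c)
  have hFi : ∀ c, Integrable (F c) ∧ ∫ x, ‖F c x‖ ≤ C₁ * K.toReal * ‖c‖ := by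
    intro c
    have h := hL1 M (F c) (hmem c).1 0
    rw [multiDeriv_zero_index] at h
    refine ⟨h.1, h.2.trans ?_⟩
    rw [mul_assoc, M.val_zero, mul_one]
    refine mul_le_mul_of_nonneg_left ?_ hC₁
    refine (ENNReal.toReal_mono (ENNReal.mul_ne_top ENNReal.ofReal_ne_top hK) (hmem c).2).trans_eq ?_
    rw [ENNReal.toReal_mul, ENNReal.toReal_ofReal (tsum_nonneg fun j => norm_nonneg _),
      norm_lp_one_eq_tsum, mul_comm]
  have hFψ : ∀ c j, Integrable fun x => F c x * ψ j x := fun c j =>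
    (hFi c).1.mul_bdd (c := D j) (hψ j).aestronglyMeasurable (Eventually.of_forall (hD j))
  -- Pulling the functionals back along `c ↦ ∑ c_k g_k` moves the problem to the Banach space `ℓ¹`.
  -- The bound `D j` only ensures continuity of each functional and may grow with `j`.
  let L : ℕ → lp (fun _ : ℕ => ℂ) 1 →L[ℂ] ℂ := fun j =>
    LinearMap.mkContinuous
      { toFun := fun c => ∫ x, F c x * ψ j x
        map_add' := fun c d => by
          rw [← integral_add (hFψ c j) (hFψ d j)]
          refine integral_congr_ae (Eventually.of_forall fun x => ?_)
          simp only [F]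
          rw [← add_mul, ← (hsum c x).tsum_add (hsum d x)]
          congr 1
          refine tsum_congr fun k => ?_
          simp [add_mul]
        map_smul' := fun r c => by
          rw [RingHom.id_apply, smul_eq_mul, ← integral_const_mul]
          refine integral_congr_ae (Eventually.of_forall fun x => ?_)
          simp only [F]
          rw [← mul_assoc, ← tsum_mul_left]
          congr 1
          refine tsum_congr fun k => ?_
          simp [mul_assoc] }
      (C₁ * K.toReal * D j) fun c => by
        have hDj : 0 ≤ D j := (norm_nonneg _).trans (hD j 0)
        change ‖∫ x, F c x * ψ j x‖ ≤ _
        refine (norm_integral_le_of_norm_le ((hFi c).1.norm.mul_const (D j))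
          (Eventually.of_forall fun x => ?_)).trans ?_
        · rw [norm_mul]
          exact mul_le_mul_of_nonneg_left (hD j x) (norm_nonneg _)
        · rw [integral_mul_const]
          refine (mul_le_mul_of_nonneg_right (hFi c).2 hDj).trans_eq (by ring)
  obtain ⟨C, hC⟩ := banach_steinhaus (g := L) fun c => hb (fun j => c j) (summable_norm_lp_one c)
  refine ⟨C, fun j => ?_⟩
  -- The `j`-th unit vector has norm `1` and produces `g j`, so the uniform operator bound controls
  -- the diagonal pairing.
  have h1 := (L j).le_opNorm (lp.single 1 j (1 : ℂ))
  have h2 : L j (lp.single 1 j (1 : ℂ)) = ∫ x, g j x * ψ j x := by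
    change ∫ x, F (lp.single 1 j (1 : ℂ)) x * ψ j x = _
    congr 1
    funext x
    congr 1
    simp only [F]
    rw [tsum_eq_single j]
    · simp
    · intro k hk
      simp [lp.single_apply, hk]
  rw [h2, lp.norm_single (by simp), norm_one, mul_one] at h1
  exact h1.trans (hC j)

end Series

/-! ### Growth of step norms under translation and modulation. -/

section Shifts

variable {n : ℕ}

/-- Measurability is automatic for smooth functions and these weights, so finiteness of the norm is
the only condition to check. -/
theorem mem_stepSpace_of_eNorm_lt_top {p : ℝ≥0∞} [Fact (1 ≤ p)] {M A : WeightSequence n}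
    {l : PosReal} {f : EuclideanSpace ℝ (Fin n) → ℂ} (hf : ContDiff ℝ ∞ f)
    (h : eNorm p M (A.weight l) f < ⊤) : f ∈ stepSpace p M (A.weight l) := by
  refine ⟨hf, fun α => ⟨((A.measurable_weight l).smul
    (multiDeriv_contDiff α hf).continuous.measurable).aestronglyMeasurable, ?_⟩, h⟩
  exact (eLpNorm_le_eNorm_mul p M _ f α).trans_lt (ENNReal.mul_lt_top h ENNReal.ofReal_lt_top)

/-- The dilated index `2 l`. -/
def PosReal.double (l : PosReal) : PosReal := ⟨2 * l, mul_pos two_pos l.2⟩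

theorem PosReal.coe_double (l : PosReal) : (l.double : ℝ) = 2 * l := rfl

theorem PosReal.le_double (l : PosReal) : l ≤ l.double := by
  change (l : ℝ) ≤ 2 * l
  linarith [l.2]

theorem WeightSequence.scale_val (M : WeightSequence n) (l : PosReal) (α : Fin n → ℕ) :
    (M.scale l).val α = (l : ℝ) ^ order α * M.val α := rfl

theorem WeightSequence.scale_mono (M : WeightSequence n) {l k : PosReal} (h : l ≤ k)
    (α : Fin n → ℕ) : (M.scale l).val α ≤ (M.scale k).val α :=
  mul_le_mul_of_nonneg_right (pow_le_pow_left₀ l.2.le h _) (M.pos α).le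

theorem WeightSequence.IsIsotropic.weight_double_add_le {A : WeightSequence n} {a : ℕ → ℝ}
    (hA : A.IsIsotropic a) (i : Fin n) (l : PosReal) (x : EuclideanSpace ℝ (Fin n)) (t : ℝ) :
    A.weight l.double (x + EuclideanSpace.single i t) ≤
      Real.exp (A.axial i (|t| / l)) * A.weight l x := by
  have hl := l.2
  rw [WeightSequence.weight, WeightSequence.weight, ← Real.exp_add, Real.exp_le_exp]
  have h := hA.assoc_add_le i ((l.double : ℝ)⁻¹ • x) ((l.double : ℝ)⁻¹ * t)
  have h1 : (2 : ℝ) • (l.double : ℝ)⁻¹ • x = (l : ℝ)⁻¹ • x := by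
    rw [smul_smul, PosReal.coe_double]; congr 1; field_simp
  have h2 : 2 * |(l.double : ℝ)⁻¹ * t| = |t| / l := by
    rw [PosReal.coe_double, abs_mul, abs_of_pos (by positivity)]; field_simp
  have h3 : (l.double : ℝ)⁻¹ • (x + EuclideanSpace.single i t) =
      (l.double : ℝ)⁻¹ • x + EuclideanSpace.single i ((l.double : ℝ)⁻¹ * t) := by
    rw [smul_add]
    congr 1
    ext j
    by_cases hj : j = i
    · subst hj; simp
    · simp [hj]
  rw [h1, h2] at h
  rw [h3]
  linarith

/-- The norm of a translate. -/
theorem WeightSequence.IsIsotropic.eNorm_translate_le {A : WeightSequence n} {a : ℕ → ℝ}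
    (hA : A.IsIsotropic a) (i : Fin n) (p : ℝ≥0∞) (M : WeightSequence n) (l : PosReal)
    {f : EuclideanSpace ℝ (Fin n) → ℂ} (hf : ContDiff ℝ ∞ f) (t : ℝ) :
    eNorm p (M.scale l.double) (A.weight l.double) (fun x => f (x - EuclideanSpace.single i t)) ≤
      ENNReal.ofReal (Real.exp (A.axial i (|t| / l))) *
        eNorm p (M.scale l) (A.weight l) f := by
  rw [eNorm_le_iff]
  intro α
  rw [multiDeriv_comp_sub α _ hf]
  set y : EuclideanSpace ℝ (Fin n) := EuclideanSpace.single i t with hy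
  have hc := (multiDeriv_contDiff α hf).continuous.measurable
  -- Translation invariance of the measure moves the shift from the function to the weight, where
  -- doubling the index absorbs it.
  have h1 : eLpNorm (fun x => A.weight l.double x • multiDeriv α f (x - y)) p volume =
      eLpNorm (fun x => A.weight l.double (x + y) • multiDeriv α f x) p volume := by
    rw [← eLpNorm_comp_measurePreserving (ν := volume) (f := fun x => x - y)
      (g := fun x => A.weight l.double (x + y) • multiDeriv α f x) ?_
      (measurePreserving_sub_right volume y)]
    · congr 1
      funext x
      simp
    · exact (((A.measurable_weight _).comp (measurable_add_const y)).smul hc).aestronglyMeasurable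
  rw [h1]
  have h2 : eLpNorm (fun x => A.weight l.double (x + y) • multiDeriv α f x) p volume ≤
      ENNReal.ofReal (Real.exp (A.axial i (|t| / l))) *
        eLpNorm (fun x => A.weight l x • multiDeriv α f x) p volume := by
    refine eLpNorm_le_mul_eLpNorm_of_ae_le_mul (Eventually.of_forall fun x => ?_) p
    rw [norm_smul, norm_smul, ← mul_assoc, Real.norm_of_nonneg (A.weight_pos _ _).le,
      Real.norm_of_nonneg (A.weight_pos _ _).le]
    exact mul_le_mul_of_nonneg_right (hA.weight_double_add_le i l x t) (norm_nonneg _)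
  refine h2.trans ?_
  rw [mul_assoc]
  refine mul_le_mul_right ((eLpNorm_le_eNorm_mul p (M.scale l) _ f α).trans ?_) _
  exact mul_le_mul_right (ENNReal.ofReal_le_ofReal (M.scale_mono l.le_double α)) _

/-- The associated function bounds `|τ| ^ (k - j)` by `m (k - j) * l ^ (k - j)` times the
exponential, and `m (b + j) * m (k - j) ≤ m (b + k)` removes the dependence on `j`. The binomial
coefficients sum to `2 ^ k`, which the doubled index absorbs. -/
theorem WeightSequence.LogConvex.sum_choose_mul_le {M : WeightSequence n} {m : ℕ → ℝ}
    (hMc : M.LogConvex) (hM : M.IsIsotropic m) (i : Fin n) (l : PosReal) (τ : ℝ) (b k : ℕ) :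
    ∑ j ∈ Finset.range (k + 1),
        ((k.choose j : ℝ) * |τ| ^ (k - j)) * ((l : ℝ) ^ (b + j) * m (b + j)) ≤
      Real.exp (M.axial i (|τ| / l)) * ((l.double : ℝ) ^ (b + k) * m (b + k)) := by
  have hl := l.2
  set W := Real.exp (M.axial i (|τ| / l)) with hW
  have hmp := hM.pos i
  have h1 : ∀ j ∈ Finset.range (k + 1),
      ((k.choose j : ℝ) * |τ| ^ (k - j)) * ((l : ℝ) ^ (b + j) * m (b + j)) ≤
        (k.choose j : ℝ) * (W * ((l : ℝ) ^ (b + k) * m (b + k))) := by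
    intro j hj
    have hjk : j ≤ k := by simpa [Nat.lt_succ_iff] using hj
    rw [mul_assoc]
    refine mul_le_mul_of_nonneg_left ?_ (Nat.cast_nonneg _)
    have h2 := hM.pow_le_axial i (t := |τ| / l) (by positivity) (k - j)
    rw [div_pow, div_le_iff₀ (by positivity)] at h2
    have h3 := hMc.mul_le hM i (b + j) (k - j)
    rw [show b + j + (k - j) = b + k by omega] at h3
    calc |τ| ^ (k - j) * ((l : ℝ) ^ (b + j) * m (b + j))
        ≤ (m (k - j) * W * (l : ℝ) ^ (k - j)) * ((l : ℝ) ^ (b + j) * m (b + j)) :=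
          mul_le_mul_of_nonneg_right h2 (mul_pos (by positivity) (hmp _)).le
      _ = W * ((l : ℝ) ^ (b + j + (k - j)) * (m (b + j) * m (k - j))) := by
          rw [pow_add]; ring
      _ = W * ((l : ℝ) ^ (b + k) * (m (b + j) * m (k - j))) := by
          rw [show b + j + (k - j) = b + k by omega]
      _ ≤ _ := by
          refine mul_le_mul_of_nonneg_left ?_ (Real.exp_pos _).le
          exact mul_le_mul_of_nonneg_left h3 (by positivity)
  refine (Finset.sum_le_sum h1).trans ?_
  rw [← Finset.sum_mul]
  have h4 : ∑ j ∈ Finset.range (k + 1), (k.choose j : ℝ) = 2 ^ k := by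
    exact_mod_cast Nat.sum_range_choose k
  rw [h4, PosReal.coe_double, mul_pow]
  have h5 : (2 : ℝ) ^ k ≤ 2 ^ (b + k) := pow_le_pow_right₀ (by norm_num) (by omega)
  have h6 : 0 ≤ W * ((l : ℝ) ^ (b + k) * m (b + k)) :=
    mul_nonneg (Real.exp_pos _).le (mul_nonneg (by positivity) (hmp _).le)
  calc _ ≤ 2 ^ (b + k) * (W * ((l : ℝ) ^ (b + k) * m (b + k))) := mul_le_mul_of_nonneg_right h5 h6
    _ = _ := by ring

/-- The norm of a modulated function. -/
theorem WeightSequence.LogConvex.eNorm_modulation_le {M : WeightSequence n} {m : ℕ → ℝ}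
    (hMc : M.LogConvex) (hM : M.IsIsotropic m) (i : Fin n) {p : ℝ≥0∞} (hp : 1 ≤ p)
    (A : WeightSequence n) (l : PosReal)
    {f : EuclideanSpace ℝ (Fin n) → ℂ} (hf : ContDiff ℝ ∞ f) (τ : ℝ) :
    eNorm p (M.scale l.double) (A.weight l.double) (modulation i τ * f) ≤
      ENNReal.ofReal (Real.exp (M.axial i (|τ| / l))) *
        eNorm p (M.scale l) (A.weight l) f := by
  rw [eNorm_le_iff]
  intro α
  obtain ⟨β, k, hβ, rfl⟩ : ∃ (β : Fin n → ℕ) (k : ℕ), β i = 0 ∧ α = β + Pi.single i k := by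
    refine ⟨Function.update α i 0, α i, by simp, ?_⟩
    funext j
    by_cases hj : j = i
    · subst hj; simp
    · simp [hj]
  have hl := l.2
  have hmp := hM.pos i
  set E := eNorm p (M.scale l) (A.weight l) f with hE
  let c : ℕ → ℂ := fun j => (k.choose j : ℂ) * (Complex.I * τ) ^ (k - j)
  have hcn : ∀ j, ‖c j‖ = (k.choose j : ℝ) * |τ| ^ (k - j) := by
    intro j
    simp [c]
  let u : ℕ → EuclideanSpace ℝ (Fin n) → ℂ := fun j x =>
    A.weight l x • multiDeriv (β + Pi.single i j) f x
  have hum : ∀ j, AEStronglyMeasurable (u j) volume := fun j => ((A.measurable_weight l).smul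
    (multiDeriv_contDiff _ hf).continuous.measurable).aestronglyMeasurable
  have h1 : eLpNorm (fun x => A.weight l.double x •
      multiDeriv (β + Pi.single i k) (modulation i τ * f) x) p volume ≤
      eLpNorm (∑ j ∈ Finset.range (k + 1), c j • u j) p volume := by
    refine eLpNorm_mono fun x => ?_
    rw [multiDeriv_modulation_mul i τ hf β hβ k, norm_smul, Pi.mul_apply, norm_mul,
      norm_modulation, one_mul, Real.norm_of_nonneg (A.weight_pos _ _).le]
    have h2 : (∑ j ∈ Finset.range (k + 1), c j • u j) x = A.weight l x •
        (∑ j ∈ Finset.range (k + 1), c j • multiDeriv (β + Pi.single i j) f) x := by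
      simp only [Finset.sum_apply, Pi.smul_apply, u, Finset.smul_sum]
      exact Finset.sum_congr rfl fun j _ => smul_comm _ _ _
    rw [h2, norm_smul, Real.norm_of_nonneg (A.weight_pos _ _).le]
    exact mul_le_mul_of_nonneg_right (A.weight_anti l.le_double x) (norm_nonneg _)
  refine h1.trans ((eLpNorm_sum_le (fun j _ => (hum j).const_smul _) hp).trans ?_)
  calc ∑ j ∈ Finset.range (k + 1), eLpNorm (c j • u j) p volume
      ≤ ∑ j ∈ Finset.range (k + 1), E * ENNReal.ofReal
          (((k.choose j : ℝ) * |τ| ^ (k - j)) *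
            ((l : ℝ) ^ (order β + j) * m (order β + j))) := by
        refine Finset.sum_le_sum fun j _ => ?_
        rw [eLpNorm_const_smul, ← ofReal_norm, hcn,
          ENNReal.ofReal_mul (p := (k.choose j : ℝ) * |τ| ^ (k - j)) (by positivity), mul_left_comm E]
        refine mul_le_mul_right ?_ (ENNReal.ofReal _)
        have h3 := eLpNorm_le_eNorm_mul p (M.scale l) (A.weight l) f (β + Pi.single i j)
        rwa [WeightSequence.scale_val, hM, order_add, order_single] at h3
    _ = E * ENNReal.ofReal (∑ j ∈ Finset.range (k + 1), ((k.choose j : ℝ) * |τ| ^ (k - j)) *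
            ((l : ℝ) ^ (order β + j) * m (order β + j))) := by
        rw [← Finset.mul_sum, ENNReal.ofReal_sum_of_nonneg fun j _ =>
          mul_nonneg (by positivity) (mul_nonneg (by positivity) (hmp _).le)]
    _ ≤ E * ENNReal.ofReal (Real.exp (M.axial i (|τ| / l)) *
          ((l.double : ℝ) ^ (order β + k) * m (order β + k))) :=
        mul_le_mul_right (ENNReal.ofReal_le_ofReal (hMc.sum_choose_mul_le hM i l τ _ _)) _
    _ = _ := by
        rw [ENNReal.ofReal_mul (Real.exp_pos _).le, WeightSequence.scale_val, hM, order_add,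
          order_single]
        ring

end Shifts

/-! ### Translates and modulations as detectors of growth. -/

section Transfer

variable {n : ℕ}

theorem exists_bound_of_eventually_le {u : ℕ → ℝ} {C : ℝ} (h : ∀ᶠ j in atTop, u j ≤ C) :
    ∃ D, ∀ j, u j ≤ D := by
  obtain ⟨D, hD⟩ := (isBoundedUnder_of_eventually_le h : IsBoundedUnder (· ≤ ·) atTop u).bddAbove_range
  exact ⟨D, fun j => hD ⟨j, rfl⟩⟩

theorem exists_ne_top_bound_of_eventually_le {u : ℕ → ℝ≥0∞} (hu : ∀ j, u j ≠ ⊤) {K : ℝ≥0∞}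
    (hK : K ≠ ⊤) (h : ∀ᶠ j in atTop, u j ≤ K) : ∃ D ≠ ⊤, ∀ j, u j ≤ D := by
  obtain ⟨D, hD⟩ := exists_bound_of_eventually_le (u := fun j => (u j).toReal) (C := K.toReal)
    (h.mono fun j hj => ENNReal.toReal_mono hK hj)
  exact ⟨ENNReal.ofReal D, ENNReal.ofReal_ne_top, fun j =>
    (ENNReal.le_ofReal_iff_toReal_le (hu j) (ENNReal.toReal_nonneg.trans (hD j))).2 (hD j)⟩

/-- The family `Θ` detects that `V` is dominated by `U`: whenever a sequence of members of `Θ`,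
normalized by `exp (-U)`, is bounded in a step of the source and its absolutely convergent
combinations lie in suitable steps of the target, then `V` is bounded by `U` along it. -/
def Detects (p : ℝ≥0∞) [Fact (1 ≤ p)] (M A N B : WeightSequence n) (U V : ℝ → ℝ)
    (Θ : ℝ → EuclideanSpace ℝ (Fin n) → ℂ) : Prop :=
  ∃ T : ℝ, 0 ≤ T ∧ ∀ t r s : ℕ → ℝ, (∀ j, T ≤ t j) → (∀ j, 0 ≤ r j) →
    ∀ (l : PosReal) (K : ℝ≥0∞), K ≠ ⊤ →
    (∀ j, (Real.exp (-U (s j * t j)) : ℂ) • Θ (t j) ∈ gsStep p M A l) →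
    (∀ j, eNorm p (M.scale l) (A.weight l) ((Real.exp (-U (s j * t j)) : ℂ) • Θ (t j)) ≤ K) →
    (∀ c : ℕ → ℂ, (Summable fun j => ‖c j‖) → ∃ k : PosReal,
      (fun x => ∑' j, c j * ((Real.exp (-U (s j * t j)) : ℂ) • Θ (t j)) x) ∈ gsStep p N B k ∧
      ∀ᶠ j in atTop, 2 * k * r j ≤ 1) →
    ∃ C : ℝ, ∀ j, V (r j * t j) ≤ U (s j * t j) + C

theorem multiDeriv_single (i : Fin n) (k : ℕ) {f : EuclideanSpace ℝ (Fin n) → ℂ}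
    (hf : ContDiff ℝ ∞ f) : multiDeriv (Pi.single i k) f = (partialDeriv i)^[k] f := by
  simpa [multiDeriv_zero_index] using multiDeriv_add_single_nat 0 i k hf

variable {p : ℝ≥0∞} [Fact (1 ≤ p)] {M A N B : WeightSequence n} {a b m ν : ℕ → ℝ}

/-- Hölder's inequality on a unit ball. The ball enters the bound through its volume only, so the
constant does not depend on the centre and survives sliding the ball to infinity. -/
theorem norm_integral_mul_indicator_le {F φ : EuclideanSpace ℝ (Fin n) → ℂ}
    {G : EuclideanSpace ℝ (Fin n) → ℂ} (hG : MemLp G p volume) (x₀ : EuclideanSpace ℝ (Fin n))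
    {S : ℝ} (hS : 0 ≤ S)
    (h : ∀ x, ‖F x * φ x‖ ≤ S * (Metric.ball x₀ 1).indicator (fun x => ‖G x‖) x) :
    ‖∫ x, F x * φ x‖ ≤ S * (eLpNorm G p volume *
      volume (Metric.ball (0 : EuclideanSpace ℝ (Fin n)) 1) ^ (1 - 1 / p.toReal)).toReal := by
  have hfin : volume (Metric.ball x₀ 1) < ⊤ := measure_ball_lt_top
  have : IsFiniteMeasure (volume.restrict (Metric.ball x₀ 1)) := ⟨by simpa using hfin⟩
  have hGr : MemLp G p (volume.restrict (Metric.ball x₀ 1)) := hG.restrict _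
  have hGi : Integrable G (volume.restrict (Metric.ball x₀ 1)) := hGr.integrable Fact.out
  have hind : Integrable ((Metric.ball x₀ 1).indicator (fun x => ‖G x‖)) volume :=
    (integrable_indicator_iff measurableSet_ball).2 hGi.norm
  refine (norm_integral_le_of_norm_le (hind.const_mul S) (Eventually.of_forall h)).trans ?_
  rw [integral_const_mul]
  refine mul_le_mul_of_nonneg_left ?_ hS
  rw [integral_indicator measurableSet_ball, integral_norm_eq_lintegral_enorm hGr.1,
    ← eLpNorm_one_eq_lintegral_enorm]
  -- For `p = ⊤` the convention gives `1 / 0 = 0`, hence the exponent `1`, which is the correct one.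
  have hexp : 0 ≤ 1 - 1 / p.toReal := by
    rcases eq_or_ne p ⊤ with rfl | hp
    · simp
    · have : 1 ≤ p.toReal := by
        rw [← ENNReal.toReal_one]; exact ENNReal.toReal_mono hp Fact.out
      rw [sub_nonneg]
      exact (div_le_one (by linarith)).2 this
  refine ENNReal.toReal_mono (ENNReal.mul_ne_top hG.eLpNorm_ne_top
    (ENNReal.rpow_ne_top_of_nonneg hexp measure_ball_lt_top.ne)) ?_
  refine (eLpNorm_le_eLpNorm_mul_rpow_measure_univ (p := 1) (q := p) Fact.out hGr.1).trans ?_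
  rw [Measure.restrict_apply_univ, Measure.addHaar_ball_center, ENNReal.toReal_one, div_one]
  exact mul_le_mul_left (eLpNorm_mono_measure _ Measure.restrict_le_self) _

/-- Translates of a nonzero function detect the growth of the weight functions. -/
theorem detects_translates (hA : A.IsIsotropic a) (i : Fin n) {l : PosReal}
    {f : EuclideanSpace ℝ (Fin n) → ℂ} (hf : f ∈ gsStep p M A l) (hf0 : f ≠ 0) :
    Detects p M A N B (A.axial i) (B.axial i) fun t x => f (x - EuclideanSpace.single i t) := by
  obtain ⟨x₀, hx₀⟩ : ∃ x, f x ≠ 0 := by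
    by_contra! h
    exact hf0 (funext h)
  obtain ⟨S', hS', hS⟩ := hA.exists_norm_multiDeriv_le i (M.scale l) l p 0
  replace hS := hS f hf
  simp only [multiDeriv_zero_index] at hS
  set S := S' * (eNorm p (M.scale l) (A.weight l) f).toReal with hSdef
  have hS0 : 0 ≤ S := mul_nonneg hS' ENNReal.toReal_nonneg
  have hfc : Continuous f := hf.1.continuous
  set φ : EuclideanSpace ℝ (Fin n) → ℂ :=
    (Metric.ball x₀ 1).indicator fun x => (starRingEnd ℂ) (f x) with hφ
  have hφm : Measurable φ :=
    (Complex.continuous_conj.comp hfc).measurable.indicator measurableSet_ball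
  have hφS : ∀ x, ‖φ x‖ ≤ S := by
    intro x
    refine (norm_indicator_le_norm_self _ _).trans ?_
    simpa using hS x
  -- The bump is the conjugate of `f` cut off near a point where `f` is nonzero, so the pairing is
  -- the integral of `|f|²` over the ball.
  have hκ : ∫ x, f x * φ x ≠ 0 := by
    have h1 : ∀ x, f x * φ x = (((Metric.ball x₀ 1).indicator (fun x => ‖f x‖ ^ 2) x : ℝ) : ℂ) := by
      intro x
      by_cases hx : x ∈ Metric.ball x₀ 1
      · simp only [hφ, Set.indicator_of_mem hx, Complex.mul_conj']
        push_cast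
        rfl
      · simp [hφ, Set.indicator_of_notMem hx]
    simp only [h1]
    rw [integral_complex_ofReal, integral_indicator measurableSet_ball]
    refine Complex.ofReal_ne_zero.2 (ne_of_gt ?_)
    have hint : IntegrableOn (fun x => ‖f x‖ ^ 2) (Metric.ball x₀ 1) :=
      ((hfc.norm.pow 2).continuousOn.integrableOn_compact
        (isCompact_closedBall x₀ 1)).mono_set Metric.ball_subset_closedBall
    rw [setIntegral_pos_iff_support_of_nonneg_ae (Eventually.of_forall fun x => by positivity) hint]
    have hopen : IsOpen (Function.support (fun x => ‖f x‖ ^ 2) ∩ Metric.ball x₀ 1) :=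
      (isOpen_ne_fun (hfc.norm.pow 2) continuous_const).inter Metric.isOpen_ball
    exact hopen.measure_pos _ ⟨x₀, by simpa using hx₀, Metric.mem_ball_self one_pos⟩
  -- Beyond this threshold, `x_i ≥ t / 2` on the translated ball. With `2 * μ * r j ≤ 1` this gives
  -- `r j * t j ≤ x_i / μ`, so the target weight dominates the factor put into the test function.
  refine ⟨2 * (‖x₀‖ + 1), by positivity, fun t r s ht hr k K hK hg hgK hsub => ?_⟩
  have htpos : ∀ j, 0 ≤ t j := fun j => le_trans (by positivity) (ht j)
  set y : ℕ → EuclideanSpace ℝ (Fin n) := fun j => EuclideanSpace.single i (t j) with hy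
  obtain ⟨C, hC⟩ := hA.exists_bound_of_pointwise i hg hK hgK
    (ψ := fun j x => (Real.exp (B.axial i (r j * t j)) : ℂ) * φ (x - y j))
    (fun j => (hφm.comp (measurable_sub_const _)).const_mul _)
    (D := fun j => Real.exp (B.axial i (r j * t j)) * S) (fun j x => by
      rw [norm_mul, Complex.norm_real, Real.norm_of_nonneg (Real.exp_pos _).le]
      exact mul_le_mul_of_nonneg_left (hφS _) (Real.exp_pos _).le) (fun c hc => by
      obtain ⟨μ, hF, hμ⟩ := hsub c hc
      set F : EuclideanSpace ℝ (Fin n) → ℂ := fun x =>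
        ∑' j, c j * ((Real.exp (-A.axial i (s j * t j)) : ℂ) • fun x => f (x - y j)) x with hFdef
      have hG := hF.2.1 0
      rw [multiDeriv_zero_index] at hG
      refine exists_bound_of_eventually_le (hμ.mono fun j hj =>
        norm_integral_mul_indicator_le hG (x₀ + y j) hS0 fun x => ?_)
      by_cases hx : x - y j ∈ Metric.ball x₀ 1
      · have hx' : x ∈ Metric.ball (x₀ + y j) 1 := by
          rw [Metric.mem_ball, dist_eq_norm] at hx ⊢
          rwa [← sub_sub, sub_right_comm]
        rw [Set.indicator_of_mem hx', norm_smul, Real.norm_of_nonneg (B.weight_pos _ _).le]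
        have hxi : t j / 2 ≤ x i := by
          have h1 : |(x - y j - x₀) i| ≤ 1 := by
            rw [Metric.mem_ball, dist_eq_norm] at hx
            exact (PiLp.norm_apply_le (x - y j - x₀) i).trans hx.le
          have h2 : |x₀ i| ≤ ‖x₀‖ := PiLp.norm_apply_le x₀ i
          have h3 := ht j
          have h4 : (x - y j - x₀) i = x i - t j - x₀ i := by simp [hy]
          rw [h4] at h1
          have := abs_le.1 h1
          have := abs_le.1 h2
          linarith
        have hw : Real.exp (B.axial i (r j * t j)) ≤ B.weight μ x := by
          refine Real.exp_le_exp.2 (B.axial_le_assoc i ?_)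
          have hμp := μ.2
          have h5 : (((μ : ℝ)⁻¹ • x : EuclideanSpace ℝ (Fin n)) i) = (μ : ℝ)⁻¹ * x i := by simp
          rw [h5, abs_of_nonneg (mul_nonneg (hr j) (htpos j)),
            abs_of_nonneg (mul_nonneg (by positivity) (by linarith [htpos j]))]
          rw [← div_eq_inv_mul, le_div_iff₀ hμp]
          have h6 := mul_le_mul_of_nonneg_right hj (htpos j)
          nlinarith
        rw [norm_mul, norm_mul, Complex.norm_real, Real.norm_of_nonneg (Real.exp_pos _).le]
        calc ‖F x‖ * (Real.exp (B.axial i (r j * t j)) * ‖φ (x - y j)‖)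
            ≤ ‖F x‖ * (B.weight μ x * S) := by
              refine mul_le_mul_of_nonneg_left ?_ (norm_nonneg _)
              exact mul_le_mul hw (hφS _) (norm_nonneg _) (B.weight_pos _ _).le
          _ = _ := by ring
      · have h0 : φ (x - y j) = 0 := Set.indicator_of_notMem hx _
        rw [h0, mul_zero, mul_zero, norm_zero]
        exact mul_nonneg hS0 (Set.indicator_nonneg (fun _ _ => norm_nonneg _) _))
  have hκ' : 0 < ‖∫ x, f x * φ x‖ := norm_pos_iff.2 hκ
  refine ⟨C / ‖∫ x, f x * φ x‖, fun j => ?_⟩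
  have h1 := hC j
  have h2 : ∫ x, ((Real.exp (-A.axial i (s j * t j)) : ℂ) • fun x => f (x - y j)) x *
      ((Real.exp (B.axial i (r j * t j)) : ℂ) * φ (x - y j)) =
      (Real.exp (B.axial i (r j * t j) - A.axial i (s j * t j)) : ℂ) * ∫ x, f x * φ x := by
    rw [← integral_sub_right_eq_self (fun x => f x * φ x) (y j), ← integral_const_mul]
    refine integral_congr_ae (Eventually.of_forall fun x => ?_)
    simp only [Pi.smul_apply, smul_eq_mul]
    rw [sub_eq_neg_add (B.axial i _), Real.exp_add]
    push_cast
    ring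
  rw [h2, norm_mul, Complex.norm_real, Real.norm_of_nonneg (Real.exp_pos _).le,
    ← le_div_iff₀ hκ'] at h1
  -- A bound on the exponential of the difference bounds the difference itself.
  have h3 := Real.add_one_le_exp (B.axial i (r j * t j) - A.axial i (s j * t j))
  linarith

open scoped FourierTransform

/-- Some term comes within a factor `2` of the supremum; otherwise the supremum would be at most
half of itself. This replaces attainment. -/
theorem WeightSequence.IsIsotropic.exists_exp_axial_le (hN : N.IsIsotropic ν) (i : Fin n) {t : ℝ}
    (ht : 0 ≤ t) : ∃ q, Real.exp (N.axial i t) ≤ 2 * (t ^ q / ν q) := by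
  by_contra! h
  have h1 : Real.exp (N.axial i t) ≤ Real.exp (N.axial i t) / 2 :=
    hN.exp_axial_le i ht fun q => by
      have h2 := h q
      have h3 := hN.pos i q
      rw [mul_div_assoc', div_lt_iff₀ h3] at h2
      linarith
  linarith [Real.exp_pos (N.axial i t)]

/-- Modulations of a nonzero function detect the growth of the derivatives. -/
theorem detects_modulations (hA : A.IsIsotropic a) (hN : N.IsIsotropic ν) (hB : B.IsIsotropic b)
    (i : Fin n) {l : PosReal} {f : EuclideanSpace ℝ (Fin n) → ℂ} (hf : f ∈ gsStep p M A l)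
    (hf0 : f ≠ 0) :
    Detects p M A N B (M.axial i) (N.axial i) fun t => modulation i t * f := by
  have hfi : Integrable f := by
    obtain ⟨_, -, h⟩ := hA.exists_integral_norm_le i l p
    simpa only [multiDeriv_zero_index] using (h _ f hf 0).1
  obtain ⟨η, hη⟩ := exists_fourier_ne_zero hf.1.continuous hfi hf0
  have hpi := Real.pi_pos
  -- For `t` beyond this threshold, `2π η_i + t ≥ t / 2`, so the shifted frequency is large enough
  -- for the decay coming from `q j` derivatives to beat `ρ j`.
  refine ⟨4 * Real.pi * |η i|, by positivity, fun t r s ht hr k K hK hg hgK hsub => ?_⟩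
  have htpos : ∀ j, 0 ≤ t j := fun j => le_trans (by positivity) (ht j)
  choose q hq using fun j => hN.exists_exp_axial_le i (mul_nonneg (hr j) (htpos j))
  set ρ : ℕ → ℝ := fun j => (r j * t j) ^ q j / ν (q j) with hρ
  have hρ0 : ∀ j, 0 ≤ ρ j := fun j =>
    div_nonneg (pow_nonneg (mul_nonneg (hr j) (htpos j)) _) (hN.pos i _).le
  -- Modulation by `t` shifts frequencies by `t / (2π)`, so evaluating the transform of the
  -- modulated function at `ξ j` recovers the fixed nonzero value at `η`.
  set ξ : ℕ → EuclideanSpace ℝ (Fin n) :=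
    fun j => η + EuclideanSpace.single i (t j / (2 * Real.pi)) with hξ
  let e : EuclideanSpace ℝ (Fin n) → EuclideanSpace ℝ (Fin n) → ℂ := fun ξ x =>
    Complex.exp (((-2 * Real.pi * inner ℝ x ξ : ℝ) : ℂ) * Complex.I)
  have hec : ∀ ξ, Continuous (e ξ) := fun ξ => by
    refine Complex.continuous_exp.comp (Continuous.mul ?_ continuous_const)
    exact Complex.continuous_ofReal.comp (continuous_const.mul (continuous_id.inner continuous_const))
  have hen : ∀ ξ x, ‖e ξ x‖ = 1 := fun ξ x => Complex.norm_exp_ofReal_mul_I _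
  have heF : ∀ (F : EuclideanSpace ℝ (Fin n) → ℂ) ξ (c : ℂ),
      ∫ x, F x * (c * e ξ x) = c * 𝓕 F ξ := by
    intro F ξ c
    rw [Real.fourier_eq', ← integral_const_mul]
    refine integral_congr_ae (Eventually.of_forall fun x => ?_)
    simp only [smul_eq_mul, e]
    ring
  obtain ⟨C, hC⟩ := hA.exists_bound_of_pointwise i hg hK hgK
    (ψ := fun j x => (ρ j : ℂ) * e (ξ j) x)
    (fun j => ((hec _).measurable).const_mul _)
    (D := ρ) (fun j x => by
      rw [norm_mul, Complex.norm_real, Real.norm_of_nonneg (hρ0 j), hen, mul_one]) (fun c hc => by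
      obtain ⟨μ, hF, hμ⟩ := hsub c hc
      set F : EuclideanSpace ℝ (Fin n) → ℂ := fun x =>
        ∑' j, c j * ((Real.exp (-M.axial i (s j * t j)) : ℂ) • (modulation i (t j) * f)) x with hFd
      obtain ⟨C, hC0, hCL⟩ := hB.exists_integral_norm_le i μ p
      have hCF := hCL (N.scale μ) F hF
      refine exists_bound_of_eventually_le (C := C * (eNorm p (N.scale μ) (B.weight μ) F).toReal)
        (hμ.mono fun j hj => ?_)
      rw [heF, norm_mul, Complex.norm_real, Real.norm_of_nonneg (hρ0 j)]
      have hμp := μ.2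
      have hνp := hN.pos i (q j)
      have h1 := abs_pow_mul_norm_fourier_le i (q j) hF.1 (fun k _ => by
        rw [← multiDeriv_single i k hF.1]
        exact (hCF _).1) (ξ j)
      have h2 := (hCF (Pi.single i (q j))).2
      rw [multiDeriv_single i _ hF.1, WeightSequence.scale_val, hN, order_single] at h2
      have h3 := h1.trans h2
      have h4 : r j * t j * μ ≤ 2 * Real.pi * |ξ j i| := by
        have h5 : ξ j i = η i + t j / (2 * Real.pi) := by simp [hξ]
        have h6 : 2 * Real.pi * ξ j i = 2 * Real.pi * η i + t j := by
          rw [h5]; field_simp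
        have h7 := le_abs_self (ξ j i)
        have h8 := neg_abs_le (η i)
        have h9 := ht j
        have h10 := mul_le_mul_of_nonneg_right hj (htpos j)
        nlinarith
      have h11 : (r j * t j * μ) ^ q j ≤ (2 * Real.pi * |ξ j i|) ^ q j :=
        pow_le_pow_left₀ (mul_nonneg (mul_nonneg (hr j) (htpos j)) hμp.le) h4 _
      have h12 := (mul_le_mul_of_nonneg_right h11 (norm_nonneg (𝓕 F (ξ j)))).trans h3
      rw [mul_pow] at h12
      have h13 : (ρ j * ‖𝓕 F (ξ j)‖) * ((μ : ℝ) ^ q j * ν (q j)) ≤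
          (C * (eNorm p (N.scale μ) (B.weight μ) F).toReal) * ((μ : ℝ) ^ q j * ν (q j)) := by
        refine (le_of_eq ?_).trans (h12.trans_eq (by ring))
        simp only [hρ]
        field_simp
      exact le_of_mul_le_mul_right h13 (by positivity))
  have hκ : 0 < ‖𝓕 f η‖ := norm_pos_iff.2 hη
  refine ⟨2 * (C / ‖𝓕 f η‖), fun j => ?_⟩
  have h1 := hC j
  have h2 : ∫ x, ((Real.exp (-M.axial i (s j * t j)) : ℂ) • (modulation i (t j) * f)) x *
      ((ρ j : ℂ) * e (ξ j) x) = ((Real.exp (-M.axial i (s j * t j)) * ρ j : ℝ) : ℂ) * 𝓕 f η := by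
    rw [← heF]
    refine integral_congr_ae (Eventually.of_forall fun x => ?_)
    have h3 : modulation i (t j) x * e (ξ j) x = e η x := by
      simp only [modulation, e]
      rw [← Complex.exp_add]
      congr 1
      rw [hξ, inner_add_right, EuclideanSpace.inner_single_right]
      simp only [conj_trivial]
      push_cast
      have : (Real.pi : ℂ) ≠ 0 := by exact_mod_cast hpi.ne'
      field_simp
      ring
    simp only [Pi.smul_apply, smul_eq_mul, Pi.mul_apply, ← h3]
    push_cast
    ring
  rw [h2, norm_mul, Complex.norm_real, Real.norm_of_nonneg
    (mul_nonneg (Real.exp_pos _).le (hρ0 j)), ← le_div_iff₀ hκ] at h1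
  have h3 := Real.add_one_le_exp (N.axial i (r j * t j) - M.axial i (s j * t j))
  rw [sub_eq_neg_add, Real.exp_add] at h3
  have h4 := mul_le_mul_of_nonneg_left (hq j) (Real.exp_pos (-M.axial i (s j * t j))).le
  change _ ≤ _ * (2 * ρ j) at h4
  linarith

end Transfer

/-! ### From inclusion to domination, and from domination to continuity. -/

section Inclusion

variable {n : ℕ} {p : ℝ≥0∞} [Fact (1 ≤ p)] {M A N B : WeightSequence n} {a b m ν : ℕ → ℝ}
  {U V : ℝ → ℝ} {Θ : ℝ → EuclideanSpace ℝ (Fin n) → ℂ}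

/-- The half of an index. -/
theorem PosReal.exists_double_eq (l : PosReal) : ∃ k : PosReal, k.double = l :=
  ⟨⟨l / 2, half_pos l.2⟩, Subtype.ext (mul_div_cancel₀ _ two_ne_zero)⟩

/-- `Θ` has growth at most `exp (U (|t| / l))` in the step with index `2 l`. -/
def HasGrowth (p : ℝ≥0∞) [Fact (1 ≤ p)] (M A : WeightSequence n) (U : ℝ → ℝ)
    (Θ : ℝ → EuclideanSpace ℝ (Fin n) → ℂ) (l : PosReal) : Prop :=
  ∃ K : ℝ≥0∞, K ≠ ⊤ ∧ ∀ t, Θ t ∈ gsStep p M A l.double ∧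
    eNorm p (M.scale l.double) (A.weight l.double) (Θ t) ≤
      ENNReal.ofReal (Real.exp (U (|t| / l))) * K

theorem eNorm_normalized_le {l : PosReal} {K : ℝ≥0∞} {t s : ℝ}
    (hmem : Θ t ∈ gsStep p M A l.double)
    (h : eNorm p (M.scale l.double) (A.weight l.double) (Θ t) ≤
      ENNReal.ofReal (Real.exp (U (|t| / l))) * K) (hU : U (|t| / l) ≤ U s) :
    eNorm p (M.scale l.double) (A.weight l.double) ((Real.exp (-U s) : ℂ) • Θ t) ≤ K := by
  rw [eNorm_smul p _ _ _ hmem.1, ← ofReal_norm, Complex.norm_real,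
    Real.norm_of_nonneg (Real.exp_pos _).le]
  refine (mul_le_mul_right h _).trans ?_
  rw [← mul_assoc, ← ENNReal.ofReal_mul (Real.exp_pos _).le, ← Real.exp_add]
  refine (mul_le_mul_left (ENNReal.ofReal_le_ofReal (Real.exp_le_one_iff.2 ?_)) K).trans_eq ?_
  · linarith
  · simp

/-- In a counterexample sequence with `s = j + 1`, the normalization eventually beats the growth in
every step, so combinations lie in the intersection. A fixed target step then suffices: index `1`
goes with `r = 1 / 2`. -/
theorem Detects.beurling_transfer (hd : Detects p M A N B U V Θ) (hA : A.IsIsotropic a)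
    (i : Fin n) (hU : ∀ s t, 0 ≤ s → s ≤ t → U s ≤ U t) (hΘ : ∀ l, HasGrowth p M A U Θ l)
    (hsub : beurling p M A ≤ beurling p N B) :
    ∃ T C s : ℝ, 0 < s ∧ ∀ t, T ≤ t → V (1 / 2 * t) ≤ U (s * t) + C := by
  obtain ⟨T, hT, hd⟩ := hd
  by_contra! hcon
  choose t ht hlt using fun j : ℕ => hcon T j (j + 1) (by positivity)
  have htpos : ∀ j, 0 ≤ t j := fun j => hT.trans (ht j)
  have hmem : ∀ (l : PosReal) (j : ℕ), (Real.exp (-U (((j : ℝ) + 1) * t j)) : ℂ) • Θ (t j) ∈ gsStep p M A l := by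
    intro l j
    obtain ⟨k, rfl⟩ := l.exists_double_eq
    obtain ⟨K, hK, hK'⟩ := hΘ k
    exact Submodule.smul_mem _ _ (hK' (t j)).1
  have hbd : ∀ l : PosReal, ∃ K ≠ ⊤, ∀ j : ℕ, eNorm p (M.scale l) (A.weight l)
      ((Real.exp (-U (((j : ℝ) + 1) * t j)) : ℂ) • Θ (t j)) ≤ K := by
    intro l
    have hml := hmem l
    obtain ⟨k, rfl⟩ := l.exists_double_eq
    obtain ⟨K, hK, hK'⟩ := hΘ k
    have hkp := k.2
    refine exists_ne_top_bound_of_eventually_le (fun j => (hml j).2.2.ne) hK ?_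
    filter_upwards [eventually_ge_atTop ⌈(k : ℝ)⁻¹⌉₊] with j hj
    refine eNorm_normalized_le (hK' (t j)).1 (hK' (t j)).2 (hU _ _ (by positivity) ?_)
    have h1 : (k : ℝ)⁻¹ ≤ j := (Nat.le_ceil _).trans (by exact_mod_cast hj)
    rw [abs_of_nonneg (htpos j), div_eq_inv_mul]
    exact mul_le_mul_of_nonneg_right (by linarith) (htpos j)
  let l₁ : PosReal := ⟨1, one_pos⟩
  obtain ⟨K, hK, hgK⟩ := hbd l₁
  obtain ⟨C, hC⟩ := hd t (fun _ => 1 / 2) (fun j => (j : ℝ) + 1) ht (fun _ => by norm_num) l₁ K hK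
    (hmem l₁) hgK (fun c hc => by
      refine ⟨l₁, ?_, Eventually.of_forall fun _ => ?_⟩
      · refine (iInf_le (gsStep p N B) l₁) (hsub ?_)
        refine (Submodule.mem_iInf _).2 fun l => ?_
        obtain ⟨K, hK, hgK⟩ := hbd l
        exact (hA.tsum_mem_stepSpace i (hmem l) hK hgK hc).1
      · change 2 * (1 : ℝ) * (1 / 2) ≤ 1
        norm_num)
  obtain ⟨j, hj⟩ := exists_nat_gt C
  linarith [hC j, hlt j]

/-- Here the source step is fixed, so `s = 1 / l` is constant, while the target step depends on the
combination. Taking `r = 1 / (j + 1)` tending to `0` makes `2 * k * r j ≤ 1` hold eventually,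
whatever `k` is. -/
theorem Detects.roumieu_transfer (hd : Detects p M A N B U V Θ) (hA : A.IsIsotropic a)
    (i : Fin n) {l : PosReal} (hΘ : HasGrowth p M A U Θ l)
    (hsub : roumieu p M A ≤ roumieu p N B) :
    ∃ T C r s : ℝ, 0 < r ∧ 0 < s ∧ ∀ t, T ≤ t → V (r * t) ≤ U (s * t) + C := by
  obtain ⟨T, hT, hd⟩ := hd
  obtain ⟨K, hK, hK'⟩ := hΘ
  by_contra! hcon
  choose t ht hlt using fun j : ℕ =>
    hcon T j (1 / ((j : ℝ) + 1)) (l : ℝ)⁻¹ (by positivity) (inv_pos.2 l.2)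
  have htpos : ∀ j, 0 ≤ t j := fun j => hT.trans (ht j)
  have hmem : ∀ j, (Real.exp (-U ((l : ℝ)⁻¹ * t j)) : ℂ) • Θ (t j) ∈ gsStep p M A l.double :=
    fun j => Submodule.smul_mem _ _ (hK' (t j)).1
  have hgK : ∀ j, eNorm p (M.scale l.double) (A.weight l.double)
      ((Real.exp (-U ((l : ℝ)⁻¹ * t j)) : ℂ) • Θ (t j)) ≤ K := fun j =>
    eNorm_normalized_le (hK' (t j)).1 (hK' (t j)).2 (by
      rw [abs_of_nonneg (htpos j), div_eq_inv_mul])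
  obtain ⟨C, hC⟩ := hd t (fun j => 1 / ((j : ℝ) + 1)) (fun _ => (l : ℝ)⁻¹) ht
    (fun _ => by positivity) l.double K hK hmem hgK (fun c hc => by
      obtain ⟨k, hk⟩ := hsub (gsStep_le_roumieu p M A l.double
        (hA.tsum_mem_stepSpace i hmem hK hgK hc).1)
      refine ⟨k, hk, ?_⟩
      filter_upwards [eventually_ge_atTop ⌈2 * (k : ℝ)⌉₊] with j hj
      have h1 : 2 * (k : ℝ) ≤ j := (Nat.le_ceil _).trans (by exact_mod_cast hj)
      rw [mul_one_div, div_le_one (by positivity)]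
      linarith)
  obtain ⟨j, hj⟩ := exists_nat_gt C
  linarith [hC j, hlt j]

theorem hasGrowth_translates (hA : A.IsIsotropic a) (i : Fin n) {l : PosReal}
    {f : EuclideanSpace ℝ (Fin n) → ℂ} (hf : f ∈ gsStep p M A l) :
    HasGrowth p M A (A.axial i) (fun t x => f (x - EuclideanSpace.single i t)) l := by
  refine ⟨_, hf.2.2.ne, fun t => ?_⟩
  have h := hA.eNorm_translate_le i p M l hf.1 t
  exact ⟨mem_stepSpace_of_eNorm_lt_top (hf.1.comp (contDiff_id.sub contDiff_const))
    (h.trans_lt (ENNReal.mul_lt_top ENNReal.ofReal_lt_top hf.2.2)), h⟩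

theorem hasGrowth_modulations (hMc : M.LogConvex) (hM : M.IsIsotropic m) (i : Fin n) {l : PosReal}
    {f : EuclideanSpace ℝ (Fin n) → ℂ} (hf : f ∈ gsStep p M A l) :
    HasGrowth p M A (M.axial i) (fun t => modulation i t * f) l := by
  refine ⟨_, hf.2.2.ne, fun t => ?_⟩
  have h := hMc.eNorm_modulation_le hM i (Fact.out : 1 ≤ p) A l hf.1 t
  exact ⟨mem_stepSpace_of_eNorm_lt_top ((modulation_contDiff i t).mul hf.1)
    (h.trans_lt (ENNReal.mul_lt_top ENNReal.ofReal_lt_top hf.2.2)), h⟩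

theorem exists_common_domination
    (h₁ : ∃ C H : ℝ, 0 < C ∧ 0 < H ∧ ∀ q, m q ≤ C * H ^ q * ν q)
    (h₂ : ∃ C H : ℝ, 0 < C ∧ 0 < H ∧ ∀ q, a q ≤ C * H ^ q * b q)
    (hν : ∀ q, 0 < ν q) (hb : ∀ q, 0 < b q) :
    ∃ C H : ℝ, 0 < C ∧ 0 < H ∧ ∀ q, m q ≤ C * H ^ q * ν q ∧ a q ≤ C * H ^ q * b q := by
  obtain ⟨C₁, H₁, hC₁, hH₁, h₁⟩ := h₁
  obtain ⟨C₂, H₂, hC₂, hH₂, h₂⟩ := h₂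
  refine ⟨max C₁ C₂, max H₁ H₂, lt_max_of_lt_left hC₁, lt_max_of_lt_left hH₁, fun q => ⟨?_, ?_⟩⟩
  · refine (h₁ q).trans (mul_le_mul_of_nonneg_right ?_ (hν q).le)
    exact mul_le_mul (le_max_left _ _) (pow_le_pow_left₀ hH₁.le (le_max_left _ _) q)
      (by positivity) (hC₁.le.trans (le_max_left _ _))
  · refine (h₂ q).trans (mul_le_mul_of_nonneg_right ?_ (hb q).le)
    exact mul_le_mul (le_max_right _ _) (pow_le_pow_left₀ hH₂.le (le_max_right _ _) q)
      (by positivity) (hC₁.le.trans (le_max_left _ _))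

theorem domination_of_beurling_le (i : Fin n) (hM : M.IsIsotropic m) (hN : N.IsIsotropic ν)
    (hA : A.IsIsotropic a) (hB : B.IsIsotropic b) (hMc : M.LogConvex) (hAc : A.LogConvex)
    (hne : beurling p M A ≠ ⊥) (hsub : beurling p M A ≤ beurling p N B) :
    ∃ C H : ℝ, 0 < C ∧ 0 < H ∧ ∀ q, m q ≤ C * H ^ q * ν q ∧ a q ≤ C * H ^ q * b q := by
  obtain ⟨f, hf, hf0⟩ := Submodule.exists_mem_ne_zero_of_ne_bot hne
  have hfl : ∀ l, f ∈ gsStep p M A l := fun l => (Submodule.mem_iInf _).1 hf l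
  refine exists_common_domination ?_ ?_ (hN.pos i) (hB.pos i)
  · obtain ⟨T, C, s, hs, h⟩ := (detects_modulations hA hN hB i (hfl ⟨1, one_pos⟩)
      hf0).beurling_transfer hA i (fun s t hs hst => M.axial_mono i hs hst)
      (fun l => hasGrowth_modulations hMc hM i (hfl l)) hsub
    exact hMc.dominated_of_axial_le hM hN i (by norm_num) hs h
  · obtain ⟨T, C, s, hs, h⟩ := (detects_translates hA i (hfl ⟨1, one_pos⟩)
      hf0).beurling_transfer hA i (fun s t hs hst => A.axial_mono i hs hst)
      (fun l => hasGrowth_translates hA i (hfl l)) hsub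
    exact hAc.dominated_of_axial_le hA hB i (by norm_num) hs h

theorem domination_of_roumieu_le (i : Fin n) (hM : M.IsIsotropic m) (hN : N.IsIsotropic ν)
    (hA : A.IsIsotropic a) (hB : B.IsIsotropic b) (hMc : M.LogConvex) (hAc : A.LogConvex)
    (hne : roumieu p M A ≠ ⊥) (hsub : roumieu p M A ≤ roumieu p N B) :
    ∃ C H : ℝ, 0 < C ∧ 0 < H ∧ ∀ q, m q ≤ C * H ^ q * ν q ∧ a q ≤ C * H ^ q * b q := by
  obtain ⟨f, ⟨l, hf⟩, hf0⟩ := Submodule.exists_mem_ne_zero_of_ne_bot hne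
  refine exists_common_domination ?_ ?_ (hN.pos i) (hB.pos i)
  · obtain ⟨T, C, r, s, hr, hs, h⟩ := (detects_modulations hA hN hB i hf
      hf0).roumieu_transfer hA i (hasGrowth_modulations hMc hM i hf) hsub
    exact hMc.dominated_of_axial_le hM hN i hr hs h
  · obtain ⟨T, C, r, s, hr, hs, h⟩ := (detects_translates hA i hf
      hf0).roumieu_transfer hA i (hasGrowth_translates hA i hf) hsub
    exact hAc.dominated_of_axial_le hA hB i hr hs h

/-- The dilated index `H l`. -/
def PosReal.dilate (H : ℝ) (hH : 0 < H) (l : PosReal) : PosReal := ⟨H * l, mul_pos hH l.2⟩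

theorem PosReal.exists_dilate_eq {H : ℝ} (hH : 0 < H) (l : PosReal) :
    ∃ k : PosReal, k.dilate H hH = l :=
  ⟨⟨l / H, div_pos l.2 hH⟩, Subtype.ext (mul_div_cancel₀ _ hH.ne')⟩

/-- Only the largest coordinate matters, and for it the factor `H ^ q` lost in the comparison is
regained by dilating the argument. -/
theorem weight_dilate_le (i : Fin n) (hA : A.IsIsotropic a) (hB : B.IsIsotropic b) {C H : ℝ}
    (hH : 0 < H) (h : ∀ q, a q ≤ C * H ^ q * b q) (l : PosReal)
    (x : EuclideanSpace ℝ (Fin n)) : B.weight (l.dilate H hH) x ≤ C * A.weight l x := by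
  obtain ⟨j, -, hj⟩ := Finset.exists_max_image Finset.univ (fun j => |x j|) ⟨i, Finset.mem_univ _⟩
  have hl := l.2
  refine hB.exp_assoc_le (R := (H * (l : ℝ))⁻¹ * |x j|) (fun k => ?_) fun q => ?_
  · have h1 : (((l.dilate H hH : PosReal) : ℝ)⁻¹ • x) k = (H * (l : ℝ))⁻¹ * x k := rfl
    rw [h1, abs_mul, abs_of_pos (by positivity)]
    exact mul_le_mul_of_nonneg_left (hj k (Finset.mem_univ k)) (by positivity)
  · have h2 := hA.abs_pow_le ((l : ℝ)⁻¹ • x) j q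
    have h3 : ((l : ℝ)⁻¹ • x) j = (l : ℝ)⁻¹ * x j := rfl
    rw [h3, abs_mul, abs_of_pos (inv_pos.2 hl)] at h2
    have h4 := h2.trans (mul_le_mul_of_nonneg_right (h q) (Real.exp_pos _).le)
    rw [mul_inv, mul_assoc, mul_pow, inv_pow, inv_mul_le_iff₀ (by positivity)]
    refine h4.trans_eq ?_
    rw [WeightSequence.weight]
    ring

theorem eNorm_dilate_le (p : ℝ≥0∞) (i : Fin n) (hM : M.IsIsotropic m) (hN : N.IsIsotropic ν)
    (hA : A.IsIsotropic a) (hB : B.IsIsotropic b) {C H : ℝ} (hC : 0 < C) (hH : 0 < H)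
    (h : ∀ q, m q ≤ C * H ^ q * ν q ∧ a q ≤ C * H ^ q * b q) (l : PosReal)
    (f : EuclideanSpace ℝ (Fin n) → ℂ) :
    eNorm p (N.scale (l.dilate H hH)) (B.weight (l.dilate H hH)) f ≤
      ENNReal.ofReal (C * C) * eNorm p (M.scale l) (A.weight l) f := by
  rw [eNorm_le_iff]
  intro α
  have hl := l.2
  have h1 : eLpNorm (fun x => B.weight (l.dilate H hH) x • multiDeriv α f x) p volume ≤
      ENNReal.ofReal C * eLpNorm (fun x => A.weight l x • multiDeriv α f x) p volume := by
    refine eLpNorm_le_mul_eLpNorm_of_ae_le_mul (Eventually.of_forall fun x => ?_) p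
    rw [norm_smul, norm_smul, ← mul_assoc, Real.norm_of_nonneg (B.weight_pos _ _).le,
      Real.norm_of_nonneg (A.weight_pos _ _).le]
    exact mul_le_mul_of_nonneg_right
      (weight_dilate_le i hA hB hH (fun q => (h q).2) l x) (norm_nonneg _)
  have h2 : ENNReal.ofReal ((M.scale l).val α) ≤
      ENNReal.ofReal C * ENNReal.ofReal ((N.scale (l.dilate H hH)).val α) := by
    rw [← ENNReal.ofReal_mul hC.le]
    refine ENNReal.ofReal_le_ofReal ?_
    have h3 : (N.scale (l.dilate H hH)).val α = (H * (l : ℝ)) ^ order α * N.val α := rfl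
    rw [WeightSequence.scale_val, h3, hM, hN, mul_pow]
    calc (l : ℝ) ^ order α * m (order α) ≤
          (l : ℝ) ^ order α * (C * H ^ order α * ν (order α)) :=
          mul_le_mul_of_nonneg_left (h _).1 (by positivity)
      _ = _ := by ring
  calc _ ≤ ENNReal.ofReal C * (eNorm p (M.scale l) (A.weight l) f *
        (ENNReal.ofReal C * ENNReal.ofReal ((N.scale (l.dilate H hH)).val α))) :=
        h1.trans (mul_le_mul_right ((eLpNorm_le_eNorm_mul p _ _ f α).trans
          (mul_le_mul_right h2 _)) _)
    _ = _ := by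
        rw [ENNReal.ofReal_mul hC.le]
        ring

theorem gsStep_le_dilate (i : Fin n) (hM : M.IsIsotropic m) (hN : N.IsIsotropic ν)
    (hA : A.IsIsotropic a) (hB : B.IsIsotropic b) {C H : ℝ} (hC : 0 < C) (hH : 0 < H)
    (h : ∀ q, m q ≤ C * H ^ q * ν q ∧ a q ≤ C * H ^ q * b q) (l : PosReal) :
    gsStep p M A l ≤ gsStep p N B (l.dilate H hH) := fun f hf =>
  mem_stepSpace_of_eNorm_lt_top hf.1 ((eNorm_dilate_le p i hM hN hA hB hC hH h l f).trans_lt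
    (ENNReal.mul_lt_top ENNReal.ofReal_lt_top hf.2.2))

theorem continuous_inclusion_gsStep {l k : PosReal} {D : ℝ}
    (h : ∀ f, eNorm p (N.scale k) (B.weight k) f ≤
      ENNReal.ofReal D * eNorm p (M.scale l) (A.weight l) f)
    (hle : gsStep p M A l ≤ gsStep p N B k) :
    Continuous[stepTopology p (M.scale l) (A.weight l), stepTopology p (N.scale k) (B.weight k)]
      (Submodule.inclusion hle) := by
  let i₁ : SeminormedAddCommGroup (gsStep p M A l) :=
    (stepNorm p (M.scale l) (A.weight l)).toAddGroupSeminorm.toSeminormedAddCommGroup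
  let i₂ : SeminormedAddCommGroup (gsStep p N B k) :=
    (stepNorm p (N.scale k) (B.weight k)).toAddGroupSeminorm.toSeminormedAddCommGroup
  refine AddMonoidHomClass.continuous_of_bound (Submodule.inclusion hle) (max D 0) fun f => ?_
  change (eNorm p (N.scale k) (B.weight k) f.1).toReal ≤
    max D 0 * (eNorm p (M.scale l) (A.weight l) f.1).toReal
  rw [← ENNReal.toReal_ofReal', ← ENNReal.toReal_mul]
  exact ENNReal.toReal_mono (ENNReal.mul_ne_top ENNReal.ofReal_ne_top f.2.2.2.ne) (h f.1)

theorem continuous_beurling_inclusion (i : Fin n) (hM : M.IsIsotropic m) (hN : N.IsIsotropic ν)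
    (hA : A.IsIsotropic a) (hB : B.IsIsotropic b) {C H : ℝ} (hC : 0 < C) (hH : 0 < H)
    (h : ∀ q, m q ≤ C * H ^ q * ν q ∧ a q ≤ C * H ^ q * b q) :
    ∃ hle : beurling p M A ≤ beurling p N B,
      Continuous[beurlingTopology p M A, beurlingTopology p N B] (Submodule.inclusion hle) := by
  have hle : beurling p M A ≤ beurling p N B := by
    refine le_iInf fun l => ?_
    obtain ⟨k, rfl⟩ := PosReal.exists_dilate_eq hH l
    exact (iInf_le _ k).trans (gsStep_le_dilate i hM hN hA hB hC hH h k)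
  refine ⟨hle, ?_⟩
  refine continuous_iInf_rng.2 fun l => continuous_induced_rng.2 ?_
  obtain ⟨k, rfl⟩ := PosReal.exists_dilate_eq hH l
  have h1 := continuous_inclusion_gsStep (eNorm_dilate_le p i hM hN hA hB hC hH h k)
    (gsStep_le_dilate i hM hN hA hB hC hH h k)
  refine continuous_iInf_dom (i := k) ?_
  exact @Continuous.comp _ _ _ (TopologicalSpace.induced
      (Submodule.inclusion (iInf_le (gsStep p M A) k : beurling p M A ≤ gsStep p M A k))
      (stepTopology p (M.scale k) (A.weight k)))
    (stepTopology p (M.scale k) (A.weight k))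
    (stepTopology p (N.scale (k.dilate H hH)) (B.weight (k.dilate H hH))) _ _ h1
    continuous_induced_dom

theorem continuous_roumieu_inclusion (i : Fin n) (hM : M.IsIsotropic m) (hN : N.IsIsotropic ν)
    (hA : A.IsIsotropic a) (hB : B.IsIsotropic b) {C H : ℝ} (hC : 0 < C) (hH : 0 < H)
    (h : ∀ q, m q ≤ C * H ^ q * ν q ∧ a q ≤ C * H ^ q * b q) :
    ∃ hle : roumieu p M A ≤ roumieu p N B,
      Continuous[roumieuTopology p M A, roumieuTopology p N B] (Submodule.inclusion hle) := by
  have hstep := gsStep_le_dilate (p := p) i hM hN hA hB hC hH h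
  have hle : roumieu p M A ≤ roumieu p N B := by
    rintro f ⟨l, hf⟩
    exact ⟨_, hstep l hf⟩
  refine ⟨hle, ?_⟩
  -- Every topology `t` admissible on the target pulls back to a locally convex topology on the
  -- source for which all steps are continuous. The finest such topology is therefore finer than the
  -- pullback.
  refine continuous_sInf_rng.2 fun t ht => continuous_iff_le_induced.2 (sInf_le ⟨fun l => ?_, ?_, ?_, ?_⟩)
  · refine continuous_induced_rng.2 ?_
    exact @Continuous.comp _ _ _ (stepTopology p (M.scale l) (A.weight l))
      (stepTopology p (N.scale (l.dilate H hH)) (B.weight (l.dilate H hH))) t _ _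
      (ht.1 (l.dilate H hH))
      (continuous_inclusion_gsStep (eNorm_dilate_le p i hM hN hA hB hC hH h l) (hstep l))
  · let := t
    have := ht.2.1
    exact topologicalAddGroup_induced (Submodule.inclusion hle)
  · let := t
    have := ht.2.2.1
    exact continuousSMul_induced (Submodule.inclusion hle)
  · let := t
    have := ht.2.2.2
    exact LocallyConvexSpace.induced ((Submodule.inclusion hle).restrictScalars ℝ)

end Inclusion

end GelfandShilov

theorem theorem1p1 {n : ℕ} (hn : 0 < n) (p : ENNReal) [Fact (1 ≤ p)]
    (M N A B : GelfandShilov.WeightSequence n) (m ν a b : ℕ → ℝ)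
    (hM : M.IsIsotropic m) (hN : N.IsIsotropic ν) (hA : A.IsIsotropic a) (hB : B.IsIsotropic b)
    (hMc : M.LogConvex) (hNc : N.LogConvex) (hAc : A.LogConvex) (hBc : B.LogConvex) :
    (GelfandShilov.beurling p M A ≠ ⊥ →
      List.TFAE [
        ∃ C H : ℝ, 0 < C ∧ 0 < H ∧
          ∀ q : ℕ, m q ≤ C * H ^ q * ν q ∧ a q ≤ C * H ^ q * b q,
        GelfandShilov.beurling p M A ≤ GelfandShilov.beurling p N B,
        ∃ h : GelfandShilov.beurling p M A ≤ GelfandShilov.beurling p N B,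
          Continuous[GelfandShilov.beurlingTopology p M A, GelfandShilov.beurlingTopology p N B]
            (Submodule.inclusion h)]) ∧
    (GelfandShilov.roumieu p M A ≠ ⊥ →
      List.TFAE [
        ∃ C H : ℝ, 0 < C ∧ 0 < H ∧
          ∀ q : ℕ, m q ≤ C * H ^ q * ν q ∧ a q ≤ C * H ^ q * b q,
        GelfandShilov.roumieu p M A ≤ GelfandShilov.roumieu p N B,
        ∃ h : GelfandShilov.roumieu p M A ≤ GelfandShilov.roumieu p N B,
          Continuous[GelfandShilov.roumieuTopology p M A, GelfandShilov.roumieuTopology p N B]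
            (Submodule.inclusion h)]) := by
  refine ⟨fun hne => ?_, fun hne => ?_⟩
  · tfae_have 1 → 3 := fun ⟨C, H, hC, hH, h⟩ =>
      GelfandShilov.continuous_beurling_inclusion ⟨0, hn⟩ hM hN hA hB hC hH h
    tfae_have 3 → 2 := fun ⟨h, _⟩ => h
    tfae_have 2 → 1 :=
      GelfandShilov.domination_of_beurling_le ⟨0, hn⟩ hM hN hA hB hMc hAc hne
    tfae_finish
  · tfae_have 1 → 3 := fun ⟨C, H, hC, hH, h⟩ =>
      GelfandShilov.continuous_roumieu_inclusion ⟨0, hn⟩ hM hN hA hB hC hH h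
    tfae_have 3 → 2 := fun ⟨h, _⟩ => h
    tfae_have 2 → 1 :=
      GelfandShilov.domination_of_roumieu_le ⟨0, hn⟩ hM hN hA hB hMc hAc hne
    tfae_finish
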